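/- Let $n\ge 1$, and let $p:\mathbb R^n\to[1,\infty)$ be measurable with $1<\operatorname{ess\,inf}_{\mathbb R^n}p\le\operatorname{ess\,sup}_{\mathbb R^n}p<\infty$ and $1/p$ log-Hölder continuous, i.e. for some $L>0$, $$\Big|\tfrac1{p(x)}-\tfrac1{p(y)}\Big|\le \frac{L}{\log(e+1/|x-y|)}\qquad\text{for all } x,y\in\mathbb R^n .$$ Let $\mathcal A:\mathbb R^n\times\mathbb R\times\mathbb R^n\to\mathbb R^n$ and $\mathcal B:\mathbb R^n\times\mathbb R\times\mathbb R^n\to\mathbb R$ be Carathéodory functions (measurable in the first argument, continuous in the last two) such that, for all $(x,t,\xi)$, $$\langle\mathcal A(x,t,\xi),\xi\rangle\ge a(x)|\xi|^{p(x)},\qquad |\mathcal A(x,t,\xi)|\le b(x)|\xi|^{p(x)-1},\qquad |\mathcal B(x,t,\xi)|\le c(x)\big(1+|\xi|^{p(x)-1}\big),$$ where $a,b,c:\mathbb R^n\to\mathbb R$ are measurable, $a$ is bounded from below by a positive constant, $a\le b$, and $b$ and $c$ are bounded from above. A function $u$ is called $(\mathcal A,\mathcal B)$-harmonic on $\mathbb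 R^n$ if it is continuous, belongs to $W^{1,p(\cdot)}_{\mathrm{loc}}(\mathbb R^n)$ (that is, $u$ and its distributional gradient $\nabla u$ lie in the variable exponent Lebesgue space $L^{p(\cdot)}(U)$ for every bounded open $U\subset\mathbb R^n$) and satisfies $$\int_{\mathbb R^n}\langle\mathcal A(x,u,\nabla u),\nabla\phi\rangle\,dx=\int_{\mathbb R^n}\mathcal B(x,u,\nabla u)\,\phi\,dx\qquad\text{for all }\phi\in C_0^\infty(\mathbb R^n).$$ Let $B_r$ denote the open ball of radius $r$ about a fixed point of $\mathbb R^n$. Suppose that there are $\delta>0$, $\gamma<0$ and a sequence $R_k\to\infty$ such that $$\operatorname*{ess\,inf}_{B_{2R_k}\setminus B_{R_k}}p\ \ge\ n+\delta+1-\gamma\qquad\text{for all }k .$$ Let $u$ be a bounded $(\mathcal A,\mathcal B)$-harmonic function on $\mathbb R^n$ with $u>0$ everywhere, such that $x\mapsto\mathcal B(x,u(x),\nabla u(x))\,u(x)^\gamma$ belongs to $L^1(\mathbb R^n)$ and $$\lim_{R\to\infty}\int_{B_R}\mathcal B(x,u(x),\nabla u(x))\,u(x)^\gamma\,dx=0 .$$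 Then $u$ is constant. -/

import Mathlib

open MeasureTheory Filter Topology Set
open scoped ContDiff

namespace VarExp

/-- Euclidean space `ℝⁿ`. -/
abbrev E (n : ℕ) : Type := EuclideanSpace ℝ (Fin n)

/-- `p⁻_A`, the essential infimum of `p` over `A` for Lebesgue measure. It is taken in the
extended reals, so that it has its usual meaning for every function and every set. -/
noncomputable def pMinus {n : ℕ} (p : E n → ℝ) (A : Set (E n)) : EReal :=
  essInf (fun x => (p x : EReal)) (volume.restrict A)

/-- `p⁺_A`, the essential supremum of `p` over `A`. -/
noncomputable def pPlus {n : ℕ} (p : E n → ℝ) (A : Set (E n)) : EReal :=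
  essSup (fun x => (p x : EReal)) (volume.restrict A)

/-- Log-Hölder continuity on `ℝⁿ`. -/
def LogHolder {n : ℕ} (α : E n → ℝ) : Prop :=
  ∃ L : ℝ, 0 < L ∧ ∀ x y : E n,
    |α x - α y| ≤ L / Real.log (Real.exp 1 + 1 / dist x y)

/-- The variable exponents on `ℝⁿ` under consideration: measurable functions `p ≥ 1` with
`1 < p⁻ ≤ p⁺ < ∞` whose reciprocal is log-Hölder continuous. -/
structure IsExponent {n : ℕ} (p : E n → ℝ) : Prop where
  aemeasurable : AEMeasurable p volume
  one_le : ∀ x, 1 ≤ p x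
  one_lt_pMinus : 1 < pMinus p univ
  pPlus_lt_top : pPlus p univ < ⊤
  logHolder : LogHolder (fun x => 1 / p x)

/-- The modular `∫_A |f(x)|^{p(x)} dx`, for scalar or vector valued `f`. -/
noncomputable def modular {n : ℕ} {F : Type*} [NormedAddCommGroup F]
    (p : E n → ℝ) (A : Set (E n)) (f : E n → F) : ENNReal :=
  ∫⁻ x in A, ENNReal.ofReal (‖f x‖ ^ p x)

/-- `f ∈ L^{p(·)}(A)`. -/
def MemLpVar {n : ℕ} {F : Type*} [NormedAddCommGroup F] [NormedSpace ℝ F]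
    (p : E n → ℝ) (A : Set (E n)) (f : E n → F) : Prop :=
  AEStronglyMeasurable f (volume.restrict A) ∧
    ∃ μ : ℝ, 0 < μ ∧ modular p A (fun x => μ⁻¹ • f x) < ⊤

/-- `φ ∈ C₀^∞(U)`. -/
structure IsTestFunction {n : ℕ} (U : Set (E n)) (φ : E n → ℝ) : Prop where
  smooth : ContDiff ℝ ∞ φ
  compact : HasCompactSupport φ
  support : tsupport φ ⊆ U

/-- `G` is the distributional gradient of `u` in the open set `U`. -/
structure IsWeakGradient {n : ℕ} (U : Set (E n)) (u : E n → ℝ) (G : E n → E n) : Prop where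
  locInt : LocallyIntegrableOn u U volume
  locInt_grad : LocallyIntegrableOn G U volume
  integral_eq : ∀ φ : E n → ℝ, IsTestFunction U φ → ∀ v : E n,
    ∫ x in U, u x * fderiv ℝ φ x v = - ∫ x in U, inner ℝ (G x) v * φ x

/-- `u ∈ W^{1,p(·)}(U)`, with distributional gradient `G`. -/
structure MemW1 {n : ℕ} (p : E n → ℝ) (U : Set (E n)) (u : E n → ℝ) (G : E n → E n) :
    Prop where
  memLp : MemLpVar p U u
  memLp_grad : MemLpVar p U G
  weakGradient : IsWeakGradient U u G

/-- `u ∈ W^{1,p(·)}_loc(ℝⁿ)`, with distributional gradient `G`: membership in `W^{1,p(·)}(U)` for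
every open set `U` with compact closure. -/
def MemW1Loc {n : ℕ} (p : E n → ℝ) (u : E n → ℝ) (G : E n → E n) : Prop :=
  ∀ U : Set (E n), IsOpen U → Bornology.IsBounded U → MemW1 p U u G

/-- Carathéodory functions: Lebesgue measurable in the first argument and continuous in the pair of
the other two. -/
structure IsCaratheodory {n : ℕ} {F : Type*} [TopologicalSpace F] [MeasurableSpace F]
    (f : E n → ℝ → E n → F) : Prop where
  measurable_fst : ∀ t ξ, AEMeasurable (fun x => f x t ξ) volume
  continuous_snd : ∀ x, Continuous (fun z : ℝ × E n => f x z.1 z.2)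

/-- The vector field `𝒜` is a Carathéodory function of `p(·)`-growth. -/
def HasGrowth {n : ℕ} (p : E n → ℝ) (A : E n → ℝ → E n → E n) : Prop :=
  IsCaratheodory A ∧
  ∃ a b : E n → ℝ, AEMeasurable a volume ∧ AEMeasurable b volume ∧
    (∃ a₀ : ℝ, 0 < a₀ ∧ ∀ x, a₀ ≤ a x) ∧
    (∀ x, a x ≤ b x) ∧
    (∃ b₀ : ℝ, ∀ x, b x ≤ b₀) ∧
    (∀ x t ξ, a x * ‖ξ‖ ^ p x ≤ inner ℝ (A x t ξ) ξ) ∧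
    (∀ x t ξ, ‖A x t ξ‖ ≤ b x * ‖ξ‖ ^ (p x - 1))

/-- The lower order term `ℬ` is a Carathéodory function with
`|ℬ(x, t, ξ)| ≤ c(x) (1 + |ξ|^{p(x) - 1})`, where `c` is measurable and bounded from above. -/
def HasLowerOrderGrowth {n : ℕ} (p : E n → ℝ) (B : E n → ℝ → E n → ℝ) : Prop :=
  IsCaratheodory B ∧
  ∃ c : E n → ℝ, AEMeasurable c volume ∧ (∃ c₀ : ℝ, ∀ x, c x ≤ c₀) ∧
    ∀ x t ξ, |B x t ξ| ≤ c x * (1 + ‖ξ‖ ^ (p x - 1))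

/-- `u` is an `(𝒜, ℬ)`-harmonic function on `ℝⁿ`, with distributional gradient `G`: a continuous
weak solution in `W^{1,p(·)}_loc(ℝⁿ)` of `-div 𝒜(x, u, ∇u) = ℬ(x, u, ∇u)`. -/
structure IsHarmonic {n : ℕ} (p : E n → ℝ) (A : E n → ℝ → E n → E n) (B : E n → ℝ → E n → ℝ)
    (u : E n → ℝ) (G : E n → E n) : Prop where
  continuous : Continuous u
  memW1Loc : MemW1Loc p u G
  weak_eq : ∀ φ : E n → ℝ, IsTestFunction univ φ →
    ∫ x, inner ℝ (A x (u x) (G x)) (gradient φ x) = ∫ x, B x (u x) (G x) * φ x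

end VarExp

/-! Test the equation with `u ^ γ * θ ^ q`, where the cutoff `θ` is 1 on `B_R`, vanishes off `B_2R`
and has slope O(1/R). Since `γ < 0`, the term with `γ * u ^ (γ - 1) * θ ^ q` has a sign and controls
∫ u^(γ-1) θ^q |∇u|^p, and Young's inequality absorbs half of it to pay for the term with ∇θ. There
remain ∫ u^(γ+p-1) |∇θ|^p and -∫ ℬ u^γ θ^q (`IsHarmonic.exists_caccioppoli`). The former lives on
the annulus, where γ + p - 1 ≥ n + δ > 0: boundedness of `u` bounds the power of `u`, and |∇θ|^p ≤
(C/R)^(n+δ) beats the volume R^n, leaving O(R^(-δ)) (`integral_cutoff_error_le`). The latter tends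
to ∫ ℬ u^γ = 0. Hence ∇u = 0 almost everywhere.

The technical core is that `u ^ γ * η` is admissible (`IsHarmonic.integral_rpow_mul_test`), the
equation being given for smooth test functions only. Replace `u` by its mollifications u_k, whose
gradients are the mollifications of ∇u. In the limit, |∇u|^(p-1) |∇u_k| ≤ |∇u|^p + |∇u_k|^p, and
log-Hölder continuity yields |∇u_k|^p ≤ C (1 + mollified |∇u|^p)
(`IsExponent.exists_norm_mollify_rpow_le`). This bound varies with k, but it converges almost
everywhere and mollification preserves its integral, so Pratt's theorem applies. -/

namespace VarExp

/-! ### Convergence of integrals and superposition operators -/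

/-- Pratt's generalised dominated convergence theorem: the dominating functions may vary, provided
that they converge almost everywhere together with their integrals. -/
theorem tendsto_integral_of_tendsto_dominating {α : Type*} [MeasurableSpace α] {μ : Measure α}
    {f : ℕ → α → ℝ} {f₀ : α → ℝ} {H : ℕ → α → ℝ} {H₀ : α → ℝ}
    (hf : ∀ k, AEStronglyMeasurable (f k) μ) (hH : ∀ k, Integrable (H k) μ)
    (hH₀ : Integrable H₀ μ) (hle : ∀ k, ∀ᵐ x ∂μ, |f k x| ≤ H k x)
    (hHlim : ∀ᵐ x ∂μ, Tendsto (fun k => H k x) atTop (𝓝 (H₀ x)))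
    (hHint : Tendsto (fun k => ∫ x, H k x ∂μ) atTop (𝓝 (∫ x, H₀ x ∂μ)))
    (hflim : ∀ᵐ x ∂μ, Tendsto (fun k => f k x) atTop (𝓝 (f₀ x))) :
    Tendsto (fun k => ∫ x, f k x ∂μ) atTop (𝓝 (∫ x, f₀ x ∂μ)) := by
  have hle' : ∀ᵐ x ∂μ, ∀ k, |f k x| ≤ H k x := ae_all_iff.2 hle
  have hf₀ : ∀ᵐ x ∂μ, |f₀ x| ≤ H₀ x := by
    filter_upwards [hle', hHlim, hflim] with x h1 h2 h3
    exact le_of_tendsto_of_tendsto' h3.abs h2 h1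
  have hfi : ∀ k, Integrable (f k) μ := fun k => (hH k).mono' (hf k) (hle k)
  -- The part of `H₀ - H k` that is positive is dominated by `H₀` itself; convergence of the
  -- integrals then forces the opposite part to vanish in the limit too.
  have hmin : Tendsto (fun k => ∫ x, max (H₀ x - H k x) 0 ∂μ) atTop (𝓝 (∫ _, 0 ∂μ)) := by
    refine tendsto_integral_of_dominated_convergence H₀
      (fun k => ((hH₀.sub (hH k)).pos_part).aestronglyMeasurable) hH₀ (fun k => ?_) ?_
    · filter_upwards [hle', hf₀] with x h1 h2
      rw [Real.norm_eq_abs, abs_of_nonneg (le_max_right _ _)]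
      have := (abs_nonneg _).trans (h1 k)
      have := (abs_nonneg _).trans h2
      exact max_le (by linarith) (by linarith)
    · filter_upwards [hHlim] with x hx
      have : Tendsto (fun k => max (H₀ x - H k x) 0) atTop (𝓝 (max (H₀ x - H₀ x) 0)) :=
        (tendsto_const_nhds.sub hx).max tendsto_const_nhds
      simpa using this
  have hpos : Tendsto (fun k => ∫ x, max (H k x - H₀ x) 0 ∂μ) atTop (𝓝 0) := by
    have h : (fun k => ∫ x, max (H k x - H₀ x) 0 ∂μ) = fun k =>
        (∫ x, H k x ∂μ) - (∫ x, H₀ x ∂μ) + ∫ x, max (H₀ x - H k x) 0 ∂μ := by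
      funext k
      rw [← integral_sub (hH k) hH₀,
        ← integral_add (f := fun x => H k x - H₀ x) (g := fun x => max (H₀ x - H k x) 0)
          ((hH k).sub hH₀) ((hH₀.sub (hH k)).pos_part)]
      congr 1
      funext x
      rcases le_total (H k x) (H₀ x) with h | h
      · rw [max_eq_right (by linarith), max_eq_left (by linarith)]; ring
      · rw [max_eq_left (by linarith), max_eq_right (by linarith)]; ring
    rw [h]
    simpa using (hHint.sub_const (∫ x, H₀ x ∂μ)).add hmin
  -- Truncating `f k` to [-H₀, H₀] gives a fixed dominating function, and the truncation error is at
  -- most (H k - H₀)⁺.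
  let g : ℕ → α → ℝ := fun k x => max (-H₀ x) (min (f k x) (H₀ x))
  have hgm : ∀ k, AEStronglyMeasurable (g k) μ := fun k =>
    hH₀.aestronglyMeasurable.neg.sup ((hf k).inf hH₀.aestronglyMeasurable)
  have hgle : ∀ k, ∀ᵐ x ∂μ, ‖g k x‖ ≤ H₀ x := fun k => by
    filter_upwards [hf₀] with x hx
    have := (abs_nonneg _).trans hx
    rw [Real.norm_eq_abs, abs_le]
    exact ⟨le_max_left _ _, max_le (by linarith) (min_le_right _ _)⟩
  have hg : Tendsto (fun k => ∫ x, g k x ∂μ) atTop (𝓝 (∫ x, f₀ x ∂μ)) := by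
    refine tendsto_integral_of_dominated_convergence H₀ hgm hH₀ hgle ?_
    filter_upwards [hflim, hf₀] with x h1 h2
    have : Tendsto (fun k => g k x) atTop (𝓝 (max (-H₀ x) (min (f₀ x) (H₀ x)))) :=
      tendsto_const_nhds.max (h1.min tendsto_const_nhds)
    rwa [min_eq_left (abs_le.1 h2).2, max_eq_right (abs_le.1 h2).1] at this
  have hgi : ∀ k, Integrable (g k) μ := fun k => hH₀.mono' (hgm k) (hgle k)
  have hdiff : Tendsto (fun k => (∫ x, f k x ∂μ) - ∫ x, g k x ∂μ) atTop (𝓝 0) := by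
    refine squeeze_zero_norm (fun k => ?_) hpos
    rw [← integral_sub (hfi k) (hgi k)]
    refine norm_integral_le_of_norm_le (((hH k).sub hH₀).pos_part) ?_
    filter_upwards [hle', hf₀] with x h1 h2
    have h3 := abs_le.1 (h1 k)
    have := (abs_nonneg _).trans h2
    have := le_max_left (H k x - H₀ x) 0
    have := le_max_right (H k x - H₀ x) 0
    rw [Real.norm_eq_abs, abs_le]
    simp only [g]
    rcases le_total (f k x) (H₀ x) with h | h
    · rw [min_eq_left h]
      rcases le_total (-H₀ x) (f k x) with h' | h'
      · rw [max_eq_right h']; constructor <;> linarith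
      · rw [max_eq_left h']; constructor <;> linarith
    · rw [min_eq_right h, max_eq_right (a := -H₀ x) (by linarith)]; constructor <;> linarith
  simpa using hdiff.add hg

/-- Superposition with a Carathéodory function preserves measurability. -/
theorem IsCaratheodory.aemeasurable_comp {n : ℕ} {F : Type*} [TopologicalSpace F]
    [TopologicalSpace.PseudoMetrizableSpace F] [MeasurableSpace F] [BorelSpace F]
    {f : E n → ℝ → E n → F} (hf : IsCaratheodory f) {z : E n → ℝ × E n}
    (hz : AEStronglyMeasurable z volume) :
    AEMeasurable (fun x => f x (z x).1 (z x).2) volume := by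
  -- On each fibre of a simple function the last two arguments are frozen; continuity in them then
  -- handles limits of simple functions.
  have hs : ∀ s : SimpleFunc (E n) (ℝ × E n),
      AEMeasurable (fun x => f x (s x).1 (s x).2) volume := by
    intro s
    have hU : (⋃ i : s.range, s ⁻¹' {(i : ℝ × E n)}) = univ := by
      ext x
      simp
    rw [← Measure.restrict_univ (μ := volume), ← hU, aemeasurable_iUnion_iff]
    rintro ⟨i, hi⟩
    refine ((hf.measurable_fst i.1 i.2).restrict).congr ?_
    filter_upwards [ae_restrict_mem (s.measurableSet_fiber i)] with x hx
    rw [show s x = i from hx]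
  refine AEMeasurable.congr (f := fun x => f x (hz.mk z x).1 (hz.mk z x).2) ?_ ?_
  · refine aemeasurable_of_tendsto_metrizable_ae atTop
      (fun k => hs (hz.stronglyMeasurable_mk.approx k)) (Eventually.of_forall fun x => ?_)
    exact ((hf.continuous_snd x).tendsto _).comp (hz.stronglyMeasurable_mk.tendsto_approx x)
  · filter_upwards [hz.ae_eq_mk] with x hx
    rw [← hx]

/-! ### Log-Hölder exponents -/

theorem tendsto_log_modulus (L : ℝ) :
    Tendsto (fun d : ℝ => L / Real.log (Real.exp 1 + 1 / d)) (𝓝[>] 0) (𝓝 0) := by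
  refine Tendsto.const_div_atTop (Real.tendsto_log_atTop.comp ?_) L
  refine tendsto_atTop_add_const_left _ _ ?_
  exact (tendsto_inv_nhdsGT_zero (𝕜 := ℝ)).congr fun d => (one_div d).symm

theorem LogHolder.continuous {n : ℕ} {α : E n → ℝ} (h : LogHolder α) : Continuous α := by
  obtain ⟨L, -, hL⟩ := h
  refine Metric.continuous_iff.2 fun x ε hε => ?_
  obtain ⟨δ, hδ, hδ'⟩ := (mem_nhdsGT_iff_exists_Ioo_subset' (zero_lt_one' ℝ)).1
    ((tendsto_log_modulus L).eventually (gt_mem_nhds hε))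
  refine ⟨δ, hδ, fun y hy => ?_⟩
  rcases eq_or_ne y x with rfl | hne
  · simpa using hε
  · exact (hL y x).trans_lt (hδ' ⟨dist_pos.2 hne, hy⟩)

theorem IsExponent.continuous {n : ℕ} {p : E n → ℝ} (hp : IsExponent p) : Continuous p := by
  have h := hp.logHolder.continuous.inv₀ fun x => by
    have := hp.one_le x
    positivity
  exact h.congr fun x => by simp

/-- The essential bound holds on a dense set, hence everywhere by continuity of `p`. -/
theorem IsExponent.exists_le {n : ℕ} {p : E n → ℝ} (hp : IsExponent p) :
    ∃ P : ℝ, 1 ≤ P ∧ ∀ x, p x ≤ P := by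
  have hlt := hp.pPlus_lt_top
  obtain ⟨P, hP, -⟩ := EReal.lt_iff_exists_real_btwn.1 hlt
  have hae : ∀ᵐ x : E n, (p x : EReal) < P := by
    have := ae_lt_of_essSup_lt hP
    simpa [pPlus] using this
  have hle : ∀ x, p x ≤ P := by
    have hd : Dense {x | p x < P} := by
      refine (Measure.dense_of_ae (μ := (volume : Measure (E n))) ?_)
      filter_upwards [hae] with x hx
      exact_mod_cast hx
    have hsub : {x | p x < P} ⊆ {x | p x ≤ P} := fun y hy => le_of_lt (α := ℝ) hy
    exact fun x => closure_minimal hsub (isClosed_le hp.continuous continuous_const) (hd x)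
  exact ⟨P, (hp.one_le 0).trans (hle 0), hle⟩

/-- The log-Hölder condition makes `t ^ |p x - p y|` bounded when `t` is at most a multiple of a
negative power of a scale `ε ≥ |x - y|`. -/
theorem IsExponent.exists_rpow_sub_le {n : ℕ} {p : E n → ℝ} (hp : IsExponent p) (m : ℕ) {N : ℝ}
    (hN : 1 ≤ N) : ∃ C : ℝ, 0 < C ∧ ∀ x y ε l, 0 < ε → dist x y ≤ ε → 1 ≤ l → l ≤ N * (ε ^ m)⁻¹ →
      l ^ (p x - p y) ≤ C := by
  obtain ⟨P, hP1, hP⟩ := hp.exists_le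
  obtain ⟨L, hL0, hL⟩ := hp.logHolder
  -- With `w` = log(e + 1/ε) one has log l ≤ log N + m w and p x - p y ≤ P² L / w; the factors `w`
  -- cancel in the product, and `1 / w ≤ 1` handles log N.
  refine ⟨N ^ (P * P * L) * Real.exp (m * (P * P * L)), by positivity, ?_⟩
  intro x y ε l hε hxy hl1 hl
  have hpx := hp.one_le x
  have hpy := hp.one_le y
  have hexp : (1 : ℝ) ≤ Real.exp 1 := Real.one_le_exp zero_le_one
  set w := Real.log (Real.exp 1 + 1 / ε) with hw
  have hw1 : 1 ≤ w := by
    rw [hw, Real.le_log_iff_exp_le (by positivity)]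
    have : 0 < 1 / ε := by positivity
    linarith
  have hwε : Real.log ε⁻¹ ≤ w := by
    apply Real.log_le_log (by positivity)
    rw [one_div]
    linarith
  -- For `x = y` the value `1 / 0 = 0` makes the modulus equal to `L`, which is not small; that case
  -- is trivial for another reason, p x - p y = 0.
  have hlogd : L / Real.log (Real.exp 1 + 1 / dist x y) ≤ L / w ∨ x = y := by
    rcases eq_or_ne x y with h | h
    · exact Or.inr h
    · left
      have hd := dist_pos.2 h
      apply div_le_div_of_nonneg_left hL0.le (by linarith)
      apply Real.log_le_log (by positivity)
      gcongr
  have hdiff : p x - p y ≤ P * P * (L / w) := by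
    rcases hlogd with h | h
    · have h1 : p x - p y = p x * p y * (1 / p y - 1 / p x) := by field_simp
      have h2 : 1 / p y - 1 / p x ≤ L / w := by
        have h3 := (hL x y).trans h
        rw [abs_sub_comm] at h3
        exact (le_abs_self _).trans h3
      rw [h1]
      calc p x * p y * (1 / p y - 1 / p x) ≤ p x * p y * (L / w) := by gcongr
        _ ≤ P * P * (L / w) := by
          have := hP x
          have := hP y
          gcongr
    · rw [h, sub_self]
      positivity
  have hl0 : 0 < l := by linarith
  have hlogl : Real.log l ≤ Real.log N + m * w := by
    calc Real.log l ≤ Real.log (N * (ε ^ m)⁻¹) := Real.log_le_log hl0 hl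
      _ = Real.log N + m * Real.log ε⁻¹ := by
        rw [Real.log_mul (by positivity) (by positivity), ← inv_pow, Real.log_pow]
      _ ≤ _ := by gcongr
  have hN0 : 0 < N := by linarith
  rw [Real.rpow_def_of_pos hl0, Real.rpow_def_of_pos hN0, ← Real.exp_add]
  apply Real.exp_le_exp.2
  calc Real.log l * (p x - p y) ≤ Real.log l * (P * P * (L / w)) := by
        gcongr
        exact Real.log_nonneg hl1
    _ ≤ (Real.log N + m * w) * (P * P * (L / w)) := by gcongr
    _ = (Real.log N * (1 / w) + m) * (P * P * L) := by field_simp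
    _ ≤ (Real.log N * 1 + m) * (P * P * L) := by
        gcongr
        · exact Real.log_nonneg hN
        · rw [div_le_one (by linarith)]; exact hw1
    _ = _ := by ring

/-! ### Mollification and its bound in variable exponent spaces -/

/-- Bump functions whose supports are the balls of radius `1 / (k + 1)` about the origin. -/
noncomputable def mollifierBump (n k : ℕ) : ContDiffBump (0 : E n) where
  rIn := 1 / ((k : ℝ) + 1) / 2
  rOut := 1 / ((k : ℝ) + 1)
  rIn_pos := by positivity
  rIn_lt_rOut := by
    have : 0 < 1 / ((k : ℝ) + 1) := by positivity
    linarith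

/-- The standard mollifier at scale `1 / (k + 1)`. -/
noncomputable def mollifier (n k : ℕ) : E n → ℝ := (mollifierBump n k).normed volume

/-- The mollification of `g` at scale `1 / (k + 1)`. -/
noncomputable def mollify {n : ℕ} {F : Type*} [NormedAddCommGroup F] [NormedSpace ℝ F] (k : ℕ)
    (g : E n → F) : E n → F :=
  convolution (mollifier n k) g (ContinuousLinearMap.lsmul ℝ ℝ) volume

section mollify

variable {n : ℕ} {F : Type*} [NormedAddCommGroup F] [NormedSpace ℝ F]

theorem mollifierBump_rOut_le_one (n k : ℕ) : (mollifierBump n k).rOut ≤ 1 := by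
  have : (0 : ℝ) ≤ k := k.cast_nonneg
  change 1 / ((k : ℝ) + 1) ≤ 1
  rw [div_le_one (by positivity)]
  linarith

theorem tendsto_mollifierBump_rOut (n : ℕ) :
    Tendsto (fun k => (mollifierBump n k).rOut) atTop (𝓝 0) :=
  tendsto_one_div_add_atTop_nhds_zero_nat

theorem mollifier_nonneg (k : ℕ) (x : E n) : 0 ≤ mollifier n k x :=
  (mollifierBump n k).nonneg_normed x

theorem continuous_mollifier (n k : ℕ) : Continuous (mollifier n k) :=
  (mollifierBump n k).continuous_normed

theorem contDiff_mollifier (n k : ℕ) : ContDiff ℝ ∞ (mollifier n k) :=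
  (mollifierBump n k).contDiff_normed

theorem hasCompactSupport_mollifier (n k : ℕ) : HasCompactSupport (mollifier n k) :=
  (mollifierBump n k).hasCompactSupport_normed

theorem integral_mollifier_sub (k : ℕ) (x : E n) : ∫ t, mollifier n k (x - t) = 1 := by
  rw [integral_sub_left_eq_self (mollifier n k) volume x]
  exact (mollifierBump n k).integral_normed

theorem integrable_mollifier (n k : ℕ) : Integrable (mollifier n k) :=
  (mollifierBump n k).integrable_normed

theorem dist_lt_of_mollifier_sub_ne_zero {k : ℕ} {x t : E n} (h : mollifier n k (x - t) ≠ 0) :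
    dist x t < 1 / ((k : ℝ) + 1) := by
  have h' : x - t ∈ Function.support (mollifier n k) := h
  rw [mollifier, ContDiffBump.support_normed_eq] at h'
  rw [dist_eq_norm]
  exact mem_ball_zero_iff.1 h'

theorem dist_lt_one_of_mollifier_sub_ne_zero {k : ℕ} {x t : E n}
    (h : mollifier n k (x - t) ≠ 0) : dist x t < 1 :=
  (dist_lt_of_mollifier_sub_ne_zero h).trans_le (mollifierBump_rOut_le_one n k)

theorem mollify_apply (k : ℕ) (g : E n → F) (x : E n) :
    mollify k g x = ∫ t, mollifier n k (x - t) • g t := by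
  rw [mollify, convolution_eq_swap]
  rfl

theorem integrable_mollifier_sub_smul (k : ℕ) {g : E n → F} (hg : LocallyIntegrable g) (x : E n) :
    Integrable fun t => mollifier n k (x - t) • g t :=
  ((hasCompactSupport_mollifier n k).convolutionExists_left (ContinuousLinearMap.lsmul ℝ ℝ)
    (continuous_mollifier n k) hg x).integrable_swap

theorem mollify_congr (k : ℕ) {g g' : E n → F} {x : E n}
    (h : ∀ t, dist x t < 1 → g t = g' t) : mollify k g x = mollify k g' x := by
  simp_rw [mollify_apply]
  congr 1
  funext t
  by_cases ht : mollifier n k (x - t) = 0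
  · simp [ht]
  · rw [h t (dist_lt_one_of_mollifier_sub_ne_zero ht)]

theorem mollify_nonneg (k : ℕ) {g : E n → ℝ} (hg : ∀ x, 0 ≤ g x) (x : E n) :
    0 ≤ mollify k g x := by
  rw [mollify_apply]
  exact integral_nonneg fun t => mul_nonneg (mollifier_nonneg k _) (hg t)

theorem le_mollify (k : ℕ) {g : E n → ℝ} (hg : LocallyIntegrable g) {x : E n} {m : ℝ}
    (h : ∀ t, dist x t < 1 → m ≤ g t) : m ≤ mollify k g x := by
  have h1 : ∫ t, mollifier n k (x - t) * m = m := by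
    rw [integral_mul_const, integral_mollifier_sub, one_mul]
  rw [mollify_apply, ← h1]
  refine integral_mono (((integrable_mollifier n k).comp_sub_left x).mul_const m)
    (integrable_mollifier_sub_smul k hg x) fun t => ?_
  by_cases ht : mollifier n k (x - t) = 0
  · simp [ht]
  · exact mul_le_mul_of_nonneg_left (h t (dist_lt_one_of_mollifier_sub_ne_zero ht))
      (mollifier_nonneg k _)

theorem mollify_le (k : ℕ) {g : E n → ℝ} (hg : LocallyIntegrable g) {x : E n} {M : ℝ}
    (h : ∀ t, dist x t < 1 → g t ≤ M) : mollify k g x ≤ M := by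
  have h1 : ∫ t, mollifier n k (x - t) * M = M := by
    rw [integral_mul_const, integral_mollifier_sub, one_mul]
  rw [mollify_apply]
  refine le_of_le_of_eq (integral_mono (integrable_mollifier_sub_smul k hg x)
    (((integrable_mollifier n k).comp_sub_left x).mul_const M) fun t => ?_) h1
  by_cases ht : mollifier n k (x - t) = 0
  · simp [ht]
  · exact mul_le_mul_of_nonneg_left (h t (dist_lt_one_of_mollifier_sub_ne_zero ht))
      (mollifier_nonneg k _)

theorem contDiff_mollify (k : ℕ) {g : E n → F} [CompleteSpace F] (hg : LocallyIntegrable g) :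
    ContDiff ℝ ∞ (mollify k g) :=
  (hasCompactSupport_mollifier n k).contDiff_convolution_left _ (contDiff_mollifier n k) hg

theorem tendsto_mollify_of_continuous [CompleteSpace F] {g : E n → F} (hg : Continuous g)
    (x : E n) : Tendsto (fun k => mollify k g x) atTop (𝓝 (g x)) :=
  ContDiffBump.convolution_tendsto_right_of_continuous (tendsto_mollifierBump_rOut n) hg x

theorem ae_tendsto_mollify [CompleteSpace F] {g : E n → F} (hg : LocallyIntegrable g) :
    ∀ᵐ x, Tendsto (fun k => mollify k g x) atTop (𝓝 (g x)) :=
  -- The outer radius is exactly twice the inner one; this bounded ratio is what Lebesgue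
  -- differentiation requires.
  ContDiffBump.ae_convolution_tendsto_right_of_locallyIntegrable (K := 2)
    (tendsto_mollifierBump_rOut n)
    (Eventually.of_forall fun k => by simp [mollifierBump]; linarith) hg

theorem integrable_mollify (k : ℕ) {g : E n → F} (hg : Integrable g) :
    Integrable (mollify k g) :=
  (integrable_mollifier n k).integrable_convolution _ hg

theorem integral_mollify [CompleteSpace F] (k : ℕ) {g : E n → F} (hg : Integrable g) :
    ∫ x, mollify k g x = ∫ x, g x := by
  have h : ∫ x, mollifier n k x = 1 := (mollifierBump n k).integral_normed
  rw [mollify, integral_convolution _ (integrable_mollifier n k) hg, h]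
  simp

theorem mollifier_le (n k : ℕ) (x : E n) :
    mollifier n k x ≤ 2 ^ n / volume.real (Metric.closedBall (0 : E n) 1) *
      ((1 / ((k : ℝ) + 1)) ^ n)⁻¹ := by
  have h := (mollifierBump n k).normed_le_div_measure_closedBall_rOut (volume : Measure (E n)) 2
    (by simp [mollifierBump]; linarith) x
  have hr : 0 ≤ (mollifierBump n k).rOut := (mollifierBump n k).rOut_pos.le
  have hv : volume.real (Metric.closedBall (0 : E n) (mollifierBump n k).rOut)
      = (1 / ((k : ℝ) + 1)) ^ n * volume.real (Metric.closedBall (0 : E n) 1) := by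
    rw [Measure.addHaar_real_closedBall' _ _ hr, finrank_euclideanSpace_fin]
    rfl
  rw [hv, finrank_euclideanSpace_fin] at h
  refine h.trans_eq ?_
  rw [div_eq_mul_inv, mul_inv]
  ring

theorem norm_mollify_le (k : ℕ) {g : E n → F} (hg : Integrable g) (x : E n) :
    ‖mollify k g x‖ ≤ 2 ^ n / volume.real (Metric.closedBall (0 : E n) 1) *
      ((1 / ((k : ℝ) + 1)) ^ n)⁻¹ * ∫ t, ‖g t‖ := by
  rw [mollify_apply, ← integral_const_mul]
  refine norm_integral_le_of_norm_le (hg.norm.const_mul _) (Eventually.of_forall fun t => ?_)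
  rw [norm_smul, Real.norm_of_nonneg (mollifier_nonneg k _)]
  exact mul_le_mul_of_nonneg_right (mollifier_le n k _) (norm_nonneg _)

/-- Above the threshold `l` the second summand alone is z (z/l)^(s-1) ≥ z. This trades a first power
for an `s`-th power when `s` varies from point to point. -/
theorem le_add_rpow_mul_rpow {z l s : ℝ} (hz : 0 ≤ z) (hl : 0 < l) (hs : 1 ≤ s) :
    z ≤ l + z ^ s * l ^ (1 - s) := by
  rcases le_total z l with h | h
  · have : 0 ≤ z ^ s * l ^ (1 - s) := by positivity
    linarith
  · have hz0 : 0 < z := hl.trans_le h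
    calc z = z ^ s * z ^ (1 - s) := by rw [← Real.rpow_add hz0]; simp
      _ ≤ z ^ s * l ^ (1 - s) := by
        gcongr ?_ * ?_
        exact Real.rpow_le_rpow_of_nonpos hl h (by linarith)
      _ ≤ _ := by linarith

/-- The pointwise form of the boundedness of mollification in `L^{p(·)}` for log-Hölder
exponents. -/
theorem IsExponent.exists_norm_mollify_rpow_le {p : E n → ℝ} (hp : IsExponent p) {g : E n → F}
    (hg : Integrable g) (hgp : Integrable fun x => ‖g x‖ ^ p x) :
    ∃ C : ℝ, 0 < C ∧ ∀ k x,
      ‖mollify k g x‖ ^ p x ≤ C * (1 + mollify k (fun y => ‖g y‖ ^ p y) x) := by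
  obtain ⟨P, hP1, hP⟩ := hp.exists_le
  set D := 2 ^ n / volume.real (Metric.closedBall (0 : E n) 1) * ∫ t, ‖g t‖
  obtain ⟨C, hC0, hC⟩ := hp.exists_rpow_sub_le n (le_max_left 1 D)
  refine ⟨2 ^ P * (1 + C), by positivity, fun k x => ?_⟩
  have hpx := hp.one_le x
  set h : E n → ℝ := fun y => ‖g y‖ ^ p y with hh
  have hh0 : 0 ≤ mollify k h x := mollify_nonneg k (fun y => by positivity) x
  set ε := 1 / ((k : ℝ) + 1) with hε
  have hε0 : 0 < ε := by positivity
  -- Half of the quantity to be bounded serves as threshold, so that the summand `l` in `key` can be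
  -- absorbed on the left.
  set l := ‖mollify k g x‖ / 2 with hl
  have hal : ‖mollify k g x‖ = 2 * l := by rw [hl]; ring
  have hl0 : 0 ≤ l := by positivity
  have h2 : (2 : ℝ) ^ p x ≤ 2 ^ P := Real.rpow_le_rpow_of_exponent_le one_le_two (hP x)
  rw [hal, Real.mul_rpow zero_le_two hl0, mul_assoc]
  suffices hs : l ^ p x ≤ (1 + C) * (1 + mollify k h x) by gcongr
  rcases le_total l 1 with hl1 | hl1
  · calc l ^ p x ≤ 1 := Real.rpow_le_one hl0 hl1 (by linarith)
      _ ≤ _ := by nlinarith [mul_nonneg hC0.le hh0]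
  · have hlpos : 0 < l := by linarith
    have hlN : l ≤ max 1 D * (ε ^ n)⁻¹ := by
      have h1 := norm_mollify_le k hg x
      calc l ≤ ‖mollify k g x‖ := by rw [hal]; linarith
        _ ≤ D * (ε ^ n)⁻¹ := by refine h1.trans_eq ?_; simp only [D]; ring
        _ ≤ _ := by gcongr; exact le_max_right _ _
    have key : ‖mollify k g x‖ ≤ l + C * l ^ (1 - p x) * mollify k h x := by
      have hint1 : Integrable fun t => mollifier n k (x - t) * l :=
        ((integrable_mollifier n k).comp_sub_left x).mul_const l
      have hint2 : Integrable fun t => mollifier n k (x - t) • h t :=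
        integrable_mollifier_sub_smul k hgp.locallyIntegrable x
      have hsum : l + C * l ^ (1 - p x) * mollify k h x = ∫ t, (mollifier n k (x - t) * l +
          C * l ^ (1 - p x) * (mollifier n k (x - t) • h t)) := by
        rw [integral_add hint1 (hint2.const_mul _), integral_mul_const, integral_mollifier_sub,
          one_mul, integral_const_mul, mollify_apply]
      rw [hsum, mollify_apply]
      refine norm_integral_le_of_norm_le (hint1.add (hint2.const_mul _))
        (Eventually.of_forall fun t => ?_)
      rw [norm_smul, Real.norm_of_nonneg (mollifier_nonneg k _)]
      by_cases ht : mollifier n k (x - t) = 0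
      · simp [ht]
      · have hd := (dist_lt_of_mollifier_sub_ne_zero ht).le
        have hCt := hC x t ε l hε0 hd hl1 hlN
        have hrho := mollifier_nonneg k (x - t)
        -- The exponent is moved from `t` to `x`; the cost l^(p x - p t) is bounded by log-Hölder
        -- continuity, since 1 ≤ l ≤ const · ε^(-n).
        have hfac : l ^ (1 - p t) = l ^ (1 - p x) * l ^ (p x - p t) := by
          rw [← Real.rpow_add hlpos]; ring_nf
        calc mollifier n k (x - t) * ‖g t‖
            ≤ mollifier n k (x - t) * (l + ‖g t‖ ^ p t * l ^ (1 - p t)) := by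
              gcongr
              exact le_add_rpow_mul_rpow (norm_nonneg _) hlpos (hp.one_le t)
          _ ≤ mollifier n k (x - t) * (l + ‖g t‖ ^ p t * (l ^ (1 - p x) * C)) := by
              rw [hfac]
              gcongr
          _ = _ := by simp only [hh, smul_eq_mul]; ring
    rw [hal] at key
    have hl' : l ≤ C * l ^ (1 - p x) * mollify k h x := by linarith
    have : l ^ p x ≤ C * mollify k h x := by
      have hone : l ^ (p x - 1) * l ^ (1 - p x) = 1 := by
        rw [← Real.rpow_add hlpos]; simp
      calc l ^ p x = l ^ (p x - 1) * l := by
            nth_rewrite 3 [← Real.rpow_one l]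
            rw [← Real.rpow_add hlpos]; simp
        _ ≤ l ^ (p x - 1) * (C * l ^ (1 - p x) * mollify k h x) := by gcongr
        _ = C * mollify k h x * (l ^ (p x - 1) * l ^ (1 - p x)) := by ring
        _ = _ := by rw [hone, mul_one]
    nlinarith

end mollify

/-! ### Mollification of weakly differentiable functions -/

section weakGradient

variable {n : ℕ} {p : E n → ℝ} {u : E n → ℝ} {G : E n → E n}

theorem MemW1Loc.locallyIntegrable_grad (h : MemW1Loc p u G) : LocallyIntegrable G := by
  intro x
  have h1 := (h (Metric.ball x 1) Metric.isOpen_ball Metric.isBounded_ball).weakGradient.locInt_grad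
    x (Metric.mem_ball_self one_pos)
  rwa [nhdsWithin_eq_nhds.2 (Metric.ball_mem_nhds x one_pos)] at h1

theorem MemW1Loc.integral_eq (h : MemW1Loc p u G) {φ : E n → ℝ} (hφ : IsTestFunction univ φ)
    (v : E n) : ∫ x, u x * fderiv ℝ φ x v = - ∫ x, inner ℝ (G x) v * φ x := by
  obtain ⟨r, hr⟩ := hφ.compact.isCompact.isBounded.subset_ball (0 : E n)
  have h1 := (h (Metric.ball 0 r) Metric.isOpen_ball Metric.isBounded_ball).weakGradient.integral_eq
    φ ⟨hφ.smooth, hφ.compact, hr⟩ v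
  rwa [setIntegral_eq_integral_of_forall_compl_eq_zero,
    setIntegral_eq_integral_of_forall_compl_eq_zero] at h1
  · intro x hx
    rw [image_eq_zero_of_notMem_tsupport fun h' => hx (hr h'), mul_zero]
  · intro x hx
    have : fderiv ℝ φ x = 0 := by
      by_contra h'
      exact hx (hr (support_fderiv_subset ℝ h'))
    simp [this]

/-- The derivative falls on the mollifier, and t ↦ mollifier(x - t) is itself a test function; the
sign from the chain rule cancels the one in the definition of the weak gradient. -/
theorem MemW1Loc.hasGradientAt_mollify (h : MemW1Loc p u G) (hu : Continuous u) (k : ℕ)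
    (x : E n) : HasGradientAt (mollify k u) (mollify k G x) x := by
  have hul : LocallyIntegrable u := hu.locallyIntegrable
  have hd : HasFDerivAt (mollify k u) _ x :=
    (hasCompactSupport_mollifier n k).hasFDerivAt_convolution_left (ContinuousLinearMap.lsmul ℝ ℝ)
      ((contDiff_mollifier n k).of_le (by simp)) hul x
  rw [hasGradientAt_iff_hasFDerivAt]
  refine hd.congr_fderiv (ContinuousLinearMap.ext fun v => Eq.symm ?_)
  set φ : E n → ℝ := fun t => mollifier n k (x - t) with hφ
  have hφt : IsTestFunction univ φ := by
    refine ⟨(contDiff_mollifier n k).comp (contDiff_const.sub contDiff_id), ?_, subset_univ _⟩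
    exact (hasCompactSupport_mollifier n k).comp_homeomorph (Homeomorph.subLeft x)
  have hφd : ∀ t, fderiv ℝ φ t v = - fderiv ℝ (mollifier n k) (x - t) v := by
    intro t
    have h1 : HasFDerivAt φ _ t :=
      (((contDiff_mollifier n k).differentiable (by simp) (x - t)).hasFDerivAt).comp t
        ((hasFDerivAt_const x t).sub (hasFDerivAt_id t))
    rw [h1.fderiv]
    simp
  have hw := h.integral_eq hφt v
  have hex : Integrable fun t => mollifier n k (x - t) • G t :=
    integrable_mollifier_sub_smul k h.locallyIntegrable_grad x
  have hL : (InnerProductSpace.toDual ℝ (E n) (mollify k G x)) v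
      = ∫ t, inner ℝ (G t) v * φ t := by
    rw [InnerProductSpace.toDual_apply_apply, mollify_apply, real_inner_comm,
      ← integral_inner hex]
    congr 1
    funext t
    rw [real_inner_smul_right, real_inner_comm, mul_comm]
  have hR : (convolution (fderiv ℝ (mollifier n k)) u
      ((ContinuousLinearMap.lsmul ℝ ℝ).precompL (E n)) volume x) v
      = ∫ t, u t * fderiv ℝ (mollifier n k) (x - t) v := by
    have hex' := (((hasCompactSupport_mollifier n k).fderiv ℝ).convolutionExists_left
      ((ContinuousLinearMap.lsmul ℝ ℝ : ℝ →L[ℝ] ℝ →L[ℝ] ℝ).precompL (E n))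
      ((contDiff_mollifier n k).continuous_fderiv (by simp)) hul x).integrable_swap
    rw [convolution_eq_swap, ContinuousLinearMap.integral_apply hex']
    congr 1
    funext t
    simp [ContinuousLinearMap.precompL_apply, mul_comm]
  refine (hL.trans ?_).trans hR.symm
  simp_rw [hφd, mul_neg, integral_neg] at hw
  linarith

end weakGradient

/-! ### Admissibility of powers of the solution as test functions -/

variable {n : ℕ} {p : E n → ℝ}

theorem MemLpVar.integrableOn_rpow {F : Type*} [NormedAddCommGroup F] [NormedSpace ℝ F]
    (hp : IsExponent p) {U : Set (E n)} {f : E n → F} (h : MemLpVar p U f) :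
    IntegrableOn (fun x => ‖f x‖ ^ p x) U := by
  obtain ⟨P, hP1, hP⟩ := hp.exists_le
  obtain ⟨hm, μ, hμ, hfin⟩ := h
  have hmeas : ∀ c : ℝ, AEStronglyMeasurable (fun x => ‖c • f x‖ ^ p x) (volume.restrict U) :=
    fun c => ((hm.const_smul c).norm.aemeasurable.pow
      hp.continuous.measurable.aemeasurable).aestronglyMeasurable
  have hint : Integrable (fun x => ‖μ⁻¹ • f x‖ ^ p x) (volume.restrict U) := by
    refine ⟨hmeas μ⁻¹, ?_⟩
    rw [hasFiniteIntegral_iff_ofReal (Eventually.of_forall fun x => by positivity)]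
    exact hfin
  refine (hint.const_mul ((max 1 μ) ^ P)).mono' (by simpa using hmeas 1)
    (Eventually.of_forall fun x => ?_)
  have h1 : f x = μ • (μ⁻¹ • f x) := by rw [smul_smul, mul_inv_cancel₀ hμ.ne', one_smul]
  have hpx := hp.one_le x
  rw [Real.norm_of_nonneg (by positivity)]
  nth_rewrite 1 [h1]
  rw [norm_smul, Real.norm_of_nonneg hμ.le, Real.mul_rpow hμ.le (norm_nonneg _)]
  gcongr
  calc μ ^ p x ≤ (max 1 μ) ^ p x := by gcongr; exact le_max_right _ _
    _ ≤ (max 1 μ) ^ P := Real.rpow_le_rpow_of_exponent_le (le_max_left _ _) (hP x)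

theorem MemW1Loc.integrableOn_grad_rpow (hp : IsExponent p) {u : E n → ℝ} {G : E n → E n}
    (h : MemW1Loc p u G) (x : E n) (r : ℝ) :
    IntegrableOn (fun x => ‖G x‖ ^ p x) (Metric.ball x r) :=
  (h _ Metric.isOpen_ball Metric.isBounded_ball).memLp_grad.integrableOn_rpow hp

theorem MemW1Loc.locallyIntegrable_grad_rpow (hp : IsExponent p) {u : E n → ℝ} {G : E n → E n}
    (h : MemW1Loc p u G) : LocallyIntegrable fun x => ‖G x‖ ^ p x :=
  fun x => ⟨_, Metric.ball_mem_nhds x one_pos, h.integrableOn_grad_rpow hp x 1⟩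

/-- Replace the smaller of `a` and `b` by the larger; no conjugate exponents are needed. -/
theorem rpow_sub_one_mul_le {a b s : ℝ} (ha : 0 ≤ a) (hb : 0 ≤ b) (hs : 1 ≤ s) :
    a ^ (s - 1) * b ≤ a ^ s + b ^ s := by
  have hs1 : 0 ≤ s - 1 := by linarith
  have hpow : ∀ t : ℝ, 0 ≤ t → t ^ (s - 1) * t = t ^ s := fun t ht => by
    rw [← Real.rpow_add_one' ht (by linarith), sub_add_cancel]
  have h1 : 0 ≤ a ^ s := by positivity
  have h2 : 0 ≤ b ^ s := by positivity
  rcases le_total a b with h | h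
  · calc a ^ (s - 1) * b ≤ b ^ (s - 1) * b := by gcongr
      _ ≤ _ := by rw [hpow b hb]; linarith
  · calc a ^ (s - 1) * b ≤ a ^ (s - 1) * a := by gcongr
      _ ≤ _ := by rw [hpow a ha]; linarith

/-- Summing both endpoint values covers either sign of the exponent at once. -/
theorem rpow_le_add_rpow {m s M a : ℝ} (hm : 0 < m) (h1 : m ≤ s) (h2 : s ≤ M) :
    s ^ a ≤ m ^ a + M ^ a := by
  have hs : 0 < s := hm.trans_le h1
  have hM : 0 < M := hs.trans_le h2
  have := Real.rpow_nonneg hm.le a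
  have := Real.rpow_nonneg hM.le a
  rcases le_total 0 a with h | h
  · have := Real.rpow_le_rpow hs.le h2 h
    linarith
  · have := Real.rpow_le_rpow_of_nonpos hm h1 h
    linarith

theorem HasGradientAt.rpow_mul {v η : E n → ℝ} {x v' η' : E n} (hv : HasGradientAt v v' x)
    (hη : HasGradientAt η η' x) (hpos : 0 < v x) (γ : ℝ) :
    HasGradientAt (fun y => v y ^ γ * η y)
      ((γ * v x ^ (γ - 1) * η x) • v' + v x ^ γ • η') x := by
  rw [hasGradientAt_iff_hasFDerivAt] at hv hη ⊢
  refine ((hv.rpow_const (p := γ) (Or.inl hpos.ne')).mul hη).congr_fderiv ?_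
  simp only [map_add, map_smul, smul_smul]
  rw [add_comm]
  congr 2
  ring

section test

variable {A : E n → ℝ → E n → E n} {B : E n → ℝ → E n → ℝ} {u : E n → ℝ} {G : E n → E n}

theorem IsHarmonic.aestronglyMeasurable_pair (hu : IsHarmonic p A B u G) :
    AEStronglyMeasurable (fun x => (u x, G x)) volume :=
  hu.continuous.aestronglyMeasurable.prodMk
    hu.memW1Loc.locallyIntegrable_grad.aestronglyMeasurable

theorem IsHarmonic.aestronglyMeasurable_field (hu : IsHarmonic p A B u G) (hA : HasGrowth p A) :
    AEStronglyMeasurable (fun x => A x (u x) (G x)) volume :=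
  (hA.1.aemeasurable_comp hu.aestronglyMeasurable_pair).aestronglyMeasurable

theorem IsHarmonic.locallyIntegrable_lowerOrder (hp : IsExponent p)
    (hu : IsHarmonic p A B u G) (hB : HasLowerOrderGrowth p B) :
    LocallyIntegrable (fun x => B x (u x) (G x)) := by
  obtain ⟨hBc, c, -, ⟨c₀, hc₀⟩, hc⟩ := hB
  have hm : AEStronglyMeasurable (fun x => B x (u x) (G x)) volume :=
    (hBc.aemeasurable_comp hu.aestronglyMeasurable_pair).aestronglyMeasurable
  have hbound : LocallyIntegrable fun x => |c₀| * (2 + ‖G x‖ ^ p x) :=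
    ((locallyIntegrable_const (2 : ℝ)).add (hu.memW1Loc.locallyIntegrable_grad_rpow hp)).smul |c₀|
  refine hbound.mono hm (Eventually.of_forall fun x => ?_)
  have h1 : ‖G x‖ ^ (p x - 1) * 1 ≤ ‖G x‖ ^ p x + 1 ^ p x :=
    rpow_sub_one_mul_le (norm_nonneg _) zero_le_one (hp.one_le x)
  rw [Real.one_rpow, mul_one] at h1
  have h2 : 0 ≤ ‖G x‖ ^ (p x - 1) := by positivity
  have h3 : 0 ≤ ‖G x‖ ^ p x := by positivity
  rw [Real.norm_of_nonneg (by positivity : 0 ≤ |c₀| * (2 + ‖G x‖ ^ p x)), Real.norm_eq_abs]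
  calc |B x (u x) (G x)| ≤ c x * (1 + ‖G x‖ ^ (p x - 1)) := hc _ _ _
    _ ≤ |c₀| * (1 + ‖G x‖ ^ (p x - 1)) := by
      gcongr
      exact (hc₀ x).trans (le_abs_self _)
    _ ≤ _ := by gcongr |c₀| * ?_; linarith

/-- The weak equation may be tested with `u ^ γ * η`. -/
theorem IsHarmonic.integral_rpow_mul_test (hp : IsExponent p) (hA : HasGrowth p A)
    (hB : HasLowerOrderGrowth p B) (hu : IsHarmonic p A B u G) (hpos : ∀ x, 0 < u x) (γ : ℝ)
    {η : E n → ℝ} (hη : IsTestFunction univ η) :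
    Integrable (fun x => inner ℝ (A x (u x) (G x))
      ((γ * u x ^ (γ - 1) * η x) • G x + u x ^ γ • gradient η x)) ∧
    ∫ x, inner ℝ (A x (u x) (G x)) ((γ * u x ^ (γ - 1) * η x) • G x + u x ^ γ • gradient η x)
      = ∫ x, B x (u x) (G x) * (u x ^ γ * η x) := by
  have huc := hu.continuous
  have hul : LocallyIntegrable u := huc.locallyIntegrable
  have hAm := hu.aestronglyMeasurable_field hA
  have hBl := hu.locallyIntegrable_lowerOrder hp hB
  obtain ⟨-, a, b, -, -, ⟨a₀, ha₀, ha⟩, hab, ⟨b₀, hb⟩, -, hAb⟩ := hA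
  have hb₀ : 0 < b₀ := ha₀.trans_le ((ha 0).trans ((hab 0).trans (hb 0)))
  have hηd : ∀ x, HasGradientAt η (gradient η x) x := fun x =>
    (hη.smooth.differentiable (by simp) x).hasGradientAt
  have hηg : Continuous (gradient η) :=
    (InnerProductSpace.toDual ℝ (E n)).symm.continuous.comp
      (hη.smooth.continuous_fderiv (by simp))
  obtain ⟨r, hr⟩ := hη.compact.isCompact.isBounded.subset_ball (0 : E n)
  have hη0 : ∀ x, x ∉ Metric.ball (0 : E n) r → η x = 0 := fun x hx =>
    image_eq_zero_of_notMem_tsupport fun h' => hx (hr h')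
  have hη0' : ∀ x, x ∉ Metric.ball (0 : E n) r → gradient η x = 0 := fun x hx => by
    have : fderiv ℝ η x = 0 := by
      by_contra h'
      exact hx (hr (support_fderiv_subset ℝ h'))
    rw [gradient, this, map_zero]
  have hηgc : HasCompactSupport (gradient η) := by
    refine HasCompactSupport.intro (isCompact_closedBall (0 : E n) r) fun x hx => hη0' x fun h => ?_
    exact hx (Metric.ball_subset_closedBall h)
  obtain ⟨T, hT⟩ := hη.compact.exists_bound_of_continuous hη.smooth.continuous
  obtain ⟨T', hT'⟩ := hηgc.exists_bound_of_continuous hηg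
  have hT0 : 0 ≤ T := (norm_nonneg _).trans (hT 0)
  have hT'0 : 0 ≤ T' := (norm_nonneg _).trans (hT' 0)
  -- bounds for `u` near the support of `η`
  obtain ⟨m, hm0, hm⟩ : ∃ m, 0 < m ∧ ∀ x ∈ Metric.closedBall (0 : E n) (r + 1), m ≤ u x := by
    -- Nothing forces `r` to be nonnegative, so the ball may be empty.
    rcases (Metric.closedBall (0 : E n) (r + 1)).eq_empty_or_nonempty with h | h
    · exact ⟨1, one_pos, fun x hx => by simp [h] at hx⟩
    · obtain ⟨y, -, hy⟩ := (isCompact_closedBall (0 : E n) (r + 1)).exists_isMinOn h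
        huc.continuousOn
      exact ⟨u y, hpos y, fun x hx => hy hx⟩
  obtain ⟨M, hM0, hM⟩ : ∃ M, 0 ≤ M ∧ ∀ x ∈ Metric.closedBall (0 : E n) (r + 1), u x ≤ M := by
    obtain ⟨M, hM⟩ := (isCompact_closedBall (0 : E n) (r + 1)).bddAbove_image huc.continuousOn
    exact ⟨max M 0, le_max_right _ _, fun x hx =>
      (hM (mem_image_of_mem _ hx)).trans (le_max_left _ _)⟩
  have hnear : ∀ {x t : E n}, x ∈ Metric.ball (0 : E n) r → dist x t < 1 →
      t ∈ Metric.ball (0 : E n) (r + 1) := fun {x t} hx ht => by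
    rw [Metric.mem_ball] at *
    linarith [dist_triangle_left t 0 x]
  have hukm : ∀ k, ∀ x ∈ Metric.ball (0 : E n) r, m ≤ mollify k u x := fun k x hx =>
    le_mollify k hul fun t ht => hm t (Metric.ball_subset_closedBall (hnear hx ht))
  have hukM : ∀ k, ∀ x ∈ Metric.ball (0 : E n) r, mollify k u x ≤ M := fun k x hx =>
    mollify_le k hul fun t ht => hM t (Metric.ball_subset_closedBall (hnear hx ht))
  have hukpos : ∀ k x, 0 < mollify k u x := fun k x => by
    obtain ⟨y, -, hy⟩ := (isCompact_closedBall x 1).exists_isMinOn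
      ⟨x, Metric.mem_closedBall_self zero_le_one⟩ huc.continuousOn
    refine (hpos y).trans_le (le_mollify k hul fun t ht => hy ?_)
    rw [Metric.mem_closedBall, dist_comm]
    exact ht.le
  have huklim : ∀ x, Tendsto (fun k => mollify k u x) atTop (𝓝 (u x)) :=
    tendsto_mollify_of_continuous huc
  -- test functions
  have hφ : ∀ k, IsTestFunction univ fun x => mollify k u x ^ γ * η x := fun k =>
    ⟨((contDiff_mollify k hul).rpow_const_of_ne fun x => (hukpos k x).ne').mul hη.smooth,
      hη.compact.mul_left, subset_univ _⟩
  have hφg : ∀ k x, gradient (fun x => mollify k u x ^ γ * η x) x =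
      (γ * mollify k u x ^ (γ - 1) * η x) • mollify k G x + mollify k u x ^ γ • gradient η x :=
    fun k x => (HasGradientAt.rpow_mul (hu.memW1Loc.hasGradientAt_mollify huc k x) (hηd x)
      (hukpos k x) γ).gradient
  have hweak : ∀ k, ∫ x, inner ℝ (A x (u x) (G x)) ((γ * mollify k u x ^ (γ - 1) * η x) •
      mollify k G x + mollify k u x ^ γ • gradient η x) =
      ∫ x, B x (u x) (G x) * (mollify k u x ^ γ * η x) := fun k => by
    rw [← hu.weak_eq _ (hφ k)]
    simp_rw [hφg]
  -- localised gradient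
  have hGl := hu.memW1Loc.locallyIntegrable_grad
  set g : E n → E n := (Metric.ball (0 : E n) (r + 1)).indicator G with hg
  have hgi : Integrable g := by
    rw [hg, integrable_indicator_iff measurableSet_ball]
    exact (hGl.integrableOn_isCompact (isCompact_closedBall 0 (r + 1))).mono_set
      Metric.ball_subset_closedBall
  have hgp : Integrable fun x => ‖g x‖ ^ p x := by
    have h1 : (fun x => ‖g x‖ ^ p x) =
        (Metric.ball (0 : E n) (r + 1)).indicator fun x => ‖G x‖ ^ p x := by
      funext x
      have hpx := hp.one_le x
      by_cases hx : x ∈ Metric.ball (0 : E n) (r + 1)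
      · simp only [hg, indicator_of_mem hx]
      · simp only [hg, indicator_of_notMem hx, norm_zero]
        exact Real.zero_rpow (by linarith)
    rw [h1, integrable_indicator_iff measurableSet_ball]
    exact hu.memW1Loc.integrableOn_grad_rpow hp 0 (r + 1)
  obtain ⟨C, hC0, hC⟩ := hp.exists_norm_mollify_rpow_le hgi hgp
  -- Mollifiers have radius at most 1, so cutting `G` off outside radius `r + 1` changes nothing
  -- within radius `r`.
  have hGk : ∀ k, ∀ x ∈ Metric.ball (0 : E n) r, mollify k G x = mollify k g x := fun k x hx =>
    mollify_congr k fun t ht => by rw [hg, indicator_of_mem (hnear hx ht)]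
  set h : E n → ℝ := fun x => ‖g x‖ ^ p x with hh
  have hh0 : ∀ k x, 0 ≤ mollify k h x := fun k x => mollify_nonneg k (fun y => by positivity) x
  set c₁ := |γ| * (m ^ (γ - 1) + M ^ (γ - 1)) * T * b₀ with hc₁
  set c₂ := (m ^ γ + M ^ γ) * T' * b₀ with hc₂
  have hc₁0 : 0 ≤ c₁ := by positivity
  have hc₂0 : 0 ≤ c₂ := by positivity
  -- The part of the dominating function that does not depend on `k`; the varying part is a multiple
  -- of the mollification of `h`.
  let base : E n → ℝ := (Metric.ball (0 : E n) r).indicator fun x =>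
    c₁ * (‖G x‖ ^ p x + C) + c₂ * (‖G x‖ ^ p x + 1)
  have hbase : Integrable base := by
    rw [integrable_indicator_iff measurableSet_ball]
    have h1 := hu.memW1Loc.integrableOn_grad_rpow hp 0 r
    have h2 : ∀ c : ℝ, IntegrableOn (fun _ => c) (Metric.ball (0 : E n) r) := fun c =>
      integrableOn_const (by finiteness)
    exact ((h1.add (h2 C)).const_mul c₁).add ((h1.add (h2 1)).const_mul c₂)
  have hS : ∀ k, ∀ x ∈ Metric.ball (0 : E n) r, ∀ α : ℝ,
      mollify k u x ^ α ≤ m ^ α + M ^ α := fun k x hx α =>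
    rpow_le_add_rpow hm0 (hukm k x hx) (hukM k x hx)
  have hle : ∀ k x, |inner ℝ (A x (u x) (G x)) ((γ * mollify k u x ^ (γ - 1) * η x) •
      mollify k G x + mollify k u x ^ γ • gradient η x)| ≤
      base x + c₁ * C * mollify k h x := fun k x => by
    by_cases hx : x ∈ Metric.ball (0 : E n) r
    · have hpx := hp.one_le x
      have hk0 := (hukpos k x).le
      have hX1 : ‖G x‖ ^ (p x - 1) * ‖mollify k G x‖ ≤
          ‖G x‖ ^ p x + C * (1 + mollify k h x) := by
        refine (rpow_sub_one_mul_le (norm_nonneg _) (norm_nonneg _) hpx).trans ?_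
        have := hC k x
        rw [← hGk k x hx] at this
        linarith
      have hX2 : ‖G x‖ ^ (p x - 1) ≤ ‖G x‖ ^ p x + 1 := by
        have := rpow_sub_one_mul_le (norm_nonneg (G x)) zero_le_one hpx
        rwa [Real.one_rpow, mul_one] at this
      have hA1 : ‖A x (u x) (G x)‖ ≤ b₀ * ‖G x‖ ^ (p x - 1) :=
        (hAb _ _ _).trans (by gcongr; exact hb x)
      have hbd : base x = c₁ * (‖G x‖ ^ p x + C) + c₂ * (‖G x‖ ^ p x + 1) :=
        indicator_of_mem hx _
      calc _ ≤ ‖A x (u x) (G x)‖ * ‖(γ * mollify k u x ^ (γ - 1) * η x) •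
            mollify k G x + mollify k u x ^ γ • gradient η x‖ := abs_real_inner_le_norm _ _
        _ ≤ (b₀ * ‖G x‖ ^ (p x - 1)) * (|γ| * (m ^ (γ - 1) + M ^ (γ - 1)) * T *
            ‖mollify k G x‖ + (m ^ γ + M ^ γ) * T') := by
          gcongr
          refine (norm_add_le _ _).trans ?_
          rw [norm_smul, norm_smul, norm_mul, norm_mul, Real.norm_eq_abs γ,
            Real.norm_of_nonneg (by positivity : 0 ≤ mollify k u x ^ (γ - 1)),
            Real.norm_of_nonneg (by positivity : 0 ≤ mollify k u x ^ γ)]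
          gcongr
          · exact hS k x hx _
          · exact hT x
          · exact hS k x hx _
          · exact hT' x
        _ = c₁ * (‖G x‖ ^ (p x - 1) * ‖mollify k G x‖) + c₂ * ‖G x‖ ^ (p x - 1) := by
          rw [hc₁, hc₂]; ring
        _ ≤ c₁ * (‖G x‖ ^ p x + C * (1 + mollify k h x)) + c₂ * (‖G x‖ ^ p x + 1) := by
          gcongr
        _ = _ := by rw [hbd]; ring
    · have h1 : base x = 0 := indicator_of_notMem hx _
      have h2 : 0 ≤ c₁ * C * mollify k h x := mul_nonneg (by positivity) (hh0 k x)
      rw [hη0 x hx, hη0' x hx, h1]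
      simpa using h2
  have hH₀ : Integrable fun x => base x + c₁ * C * h x := hbase.add (hgp.const_mul _)
  have hHlim : ∀ᵐ x, Tendsto (fun k => base x + c₁ * C * mollify k h x) atTop
      (𝓝 (base x + c₁ * C * h x)) := by
    filter_upwards [ae_tendsto_mollify hgp.locallyIntegrable] with x hx
    exact tendsto_const_nhds.add (hx.const_mul _)
  have hflim : ∀ᵐ x, Tendsto (fun k => inner ℝ (A x (u x) (G x))
      ((γ * mollify k u x ^ (γ - 1) * η x) • mollify k G x + mollify k u x ^ γ • gradient η x))
      atTop (𝓝 (inner ℝ (A x (u x) (G x))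
        ((γ * u x ^ (γ - 1) * η x) • G x + u x ^ γ • gradient η x))) := by
    filter_upwards [ae_tendsto_mollify hGl] with x hx
    have h1 : ∀ α : ℝ, Tendsto (fun k => mollify k u x ^ α) atTop (𝓝 (u x ^ α)) := fun α =>
      (huklim x).rpow_const (Or.inl (hpos x).ne')
    exact tendsto_const_nhds.inner (((((h1 _).const_mul γ).mul_const (η x)).smul hx).add
      ((h1 γ).smul_const _))
  have hfm : ∀ k, AEStronglyMeasurable (fun x => inner ℝ (A x (u x) (G x))
      ((γ * mollify k u x ^ (γ - 1) * η x) • mollify k G x + mollify k u x ^ γ • gradient η x))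
      volume := fun k => by
    have h1 : ∀ α : ℝ, Continuous fun x => mollify k u x ^ α := fun α =>
      (contDiff_mollify k hul).continuous.rpow_const fun x => Or.inl (hukpos k x).ne'
    exact hAm.inner ((((continuous_const.mul (h1 _)).mul hη.smooth.continuous).smul
      (contDiff_mollify k hGl).continuous).add ((h1 γ).smul hηg)).aestronglyMeasurable
  have hlim := tendsto_integral_of_tendsto_dominating hfm
    (fun k => hbase.add ((integrable_mollify k hgp).const_mul (c₁ * C))) hH₀
    (fun k => Eventually.of_forall (hle k)) hHlim
    (by
      -- Mollification preserves the integral, so the dominating integrals do not depend on `k`.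
      have : ∀ k, ∫ x, (base x + c₁ * C * mollify k h x) = ∫ x, (base x + c₁ * C * h x) :=
        fun k => by
          rw [integral_add hbase ((integrable_mollify k hgp).const_mul _),
            integral_add hbase (hgp.const_mul _), integral_const_mul, integral_const_mul,
            integral_mollify k hgp]
      simp only [Pi.add_apply, this]
      exact tendsto_const_nhds) hflim
  refine ⟨hH₀.mono' (aestronglyMeasurable_of_tendsto_ae atTop hfm hflim) ?_, ?_⟩
  · filter_upwards [hHlim, hflim] with x h1 h2
    exact le_of_tendsto_of_tendsto' h2.norm h1 fun k => hle k x
  · refine tendsto_nhds_unique hlim ?_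
    simp_rw [hweak]
    have hBr : IntegrableOn (fun x => B x (u x) (G x)) (Metric.ball (0 : E n) r) :=
      (hBl.integrableOn_isCompact (isCompact_closedBall 0 r)).mono_set
        Metric.ball_subset_closedBall
    -- No gradient of the mollified function occurs on this side, so a fixed bound suffices.
    refine tendsto_integral_of_dominated_convergence ((Metric.ball (0 : E n) r).indicator
      fun x => |B x (u x) (G x)| * ((m ^ γ + M ^ γ) * T)) (fun k => ?_) ?_ (fun k => ?_) ?_
    · exact hBl.aestronglyMeasurable.mul (hφ k).smooth.continuous.aestronglyMeasurable
    · rw [integrable_indicator_iff measurableSet_ball]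
      exact hBr.norm.mul_const _
    · refine Eventually.of_forall fun x => ?_
      by_cases hx : x ∈ Metric.ball (0 : E n) r
      · have hk0 := (hukpos k x).le
        rw [indicator_of_mem hx, norm_mul, norm_mul, Real.norm_eq_abs,
          Real.norm_of_nonneg (by positivity : 0 ≤ mollify k u x ^ γ)]
        gcongr
        · exact hS k x hx _
        · exact hT x
      · rw [indicator_of_notMem hx, hη0 x hx]
        simp
    · exact Eventually.of_forall fun x => (((huklim x).rpow_const
        (Or.inl (hpos x).ne')).mul_const _).const_mul _

end test

/-! ### Cutoff functions and the Caccioppoli estimate -/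

/-- Young's inequality for the cutoff term of a Caccioppoli estimate, by cases on whether the
gradient `X` dominates. -/
theorem cutoff_term_le {b τ K u θ X D s P γ : ℝ} {q : ℕ} (hb : 0 ≤ b) (hτ : 0 < τ)
    (hK1 : 1 ≤ K) (hK : q * b / τ ≤ K) (hu : 0 < u) (hθ0 : 0 ≤ θ) (hθ1 : θ ≤ 1) (hX : 0 ≤ X)
    (hD : 0 ≤ D) (hs : 1 ≤ s) (hsP : s ≤ P) (hq : P ≤ q) :
    (b * X ^ (s - 1)) * (u ^ γ * (q * θ ^ (q - 1) * D)) ≤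
      τ * (u ^ (γ - 1) * θ ^ q * X ^ s) + b * q * K ^ P * (u ^ (γ + s - 1) * D ^ s) := by
  have hq1 : 1 ≤ q := by
    have : (1 : ℝ) ≤ q := hs.trans (hsP.trans hq)
    exact_mod_cast this
  have hK0 : 0 < K := by linarith
  have hs1 : 0 ≤ s - 1 := by linarith
  have hpow : ∀ t : ℝ, 0 ≤ t → t ^ (s - 1) * t = t ^ s := fun t ht => by
    rw [← Real.rpow_add_one' ht (by linarith), sub_add_cancel]
  have hθq : θ ^ (q - 1) * θ = θ ^ q := by rw [← pow_succ, Nat.sub_add_cancel hq1]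
  have huu : u ^ (γ - 1) * u = u ^ γ := by
    rw [← Real.rpow_add_one hu.ne', sub_add_cancel]
  rcases le_total (K * u * D) (θ * X) with h | h
  · have h1 : q * b ≤ τ * K := by rwa [div_le_iff₀' hτ] at hK
    have h2 : 0 ≤ b * q * K ^ P * (u ^ (γ + s - 1) * D ^ s) := by positivity
    calc (b * X ^ (s - 1)) * (u ^ γ * (q * θ ^ (q - 1) * D))
        = (q * b) * (u ^ (γ - 1) * u * D * X ^ (s - 1) * θ ^ (q - 1)) := by rw [huu]; ring
      _ ≤ (τ * K) * (u ^ (γ - 1) * u * D * X ^ (s - 1) * θ ^ (q - 1)) := by gcongr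
      _ = τ * (u ^ (γ - 1) * X ^ (s - 1) * θ ^ (q - 1)) * (K * u * D) := by ring
      _ ≤ τ * (u ^ (γ - 1) * X ^ (s - 1) * θ ^ (q - 1)) * (θ * X) := by gcongr
      _ = τ * (u ^ (γ - 1) * (θ ^ (q - 1) * θ) * (X ^ (s - 1) * X)) := by ring
      _ = τ * (u ^ (γ - 1) * θ ^ q * X ^ s) := by rw [hθq, hpow X hX]
      _ ≤ _ := by linarith
  · have h2 : 0 ≤ τ * (u ^ (γ - 1) * θ ^ q * X ^ s) := by positivity
    -- Here `q ≥ P ≥ s` is used. The exception `0 ^ 0 = 1` is harmless: if `q = 1`, then `s = 1` as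
    -- well.
    have h3 : θ ^ (q - 1) ≤ θ ^ (s - 1) := by
      rw [← Real.rpow_natCast, Nat.cast_sub hq1, Nat.cast_one]
      exact Real.rpow_le_rpow_of_exponent_ge_of_imp hθ0 hθ1 (by linarith) fun _ h => by linarith
    have h4 : θ ^ (q - 1) * X ^ (s - 1) ≤ K ^ P * (u ^ (s - 1) * D ^ (s - 1)) := by
      calc θ ^ (q - 1) * X ^ (s - 1) ≤ θ ^ (s - 1) * X ^ (s - 1) := by gcongr
        _ = (θ * X) ^ (s - 1) := (Real.mul_rpow hθ0 hX).symm
        _ ≤ (K * u * D) ^ (s - 1) := by gcongr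
        _ = K ^ (s - 1) * (u ^ (s - 1) * D ^ (s - 1)) := by
          rw [Real.mul_rpow (by positivity) hD, Real.mul_rpow hK0.le hu.le, mul_assoc]
        _ ≤ _ := by
          gcongr
          linarith
    have h5 : u ^ γ * u ^ (s - 1) = u ^ (γ + s - 1) := by
      rw [← Real.rpow_add hu, add_sub_assoc]
    calc (b * X ^ (s - 1)) * (u ^ γ * (q * θ ^ (q - 1) * D))
        = b * q * u ^ γ * D * (θ ^ (q - 1) * X ^ (s - 1)) := by ring
      _ ≤ b * q * u ^ γ * D * (K ^ P * (u ^ (s - 1) * D ^ (s - 1))) := by gcongr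
      _ = b * q * K ^ P * ((u ^ γ * u ^ (s - 1)) * (D ^ (s - 1) * D)) := by ring
      _ = b * q * K ^ P * (u ^ (γ + s - 1) * D ^ s) := by rw [h5, hpow D hD]
      _ ≤ _ := by linarith

theorem exists_cutoff (x₀ : E n) : ∃ C : ℝ, 0 < C ∧ ∀ R : ℝ, 0 < R → ∃ θ : E n → ℝ,
    IsTestFunction (Metric.ball x₀ (2 * R)) θ ∧ (∀ x, 0 ≤ θ x) ∧ (∀ x, θ x ≤ 1) ∧
    (∀ x ∈ Metric.ball x₀ R, θ x = 1) ∧ (∀ x, ‖fderiv ℝ θ x‖ ≤ C / R) ∧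
    ∀ x, x ∉ Metric.ball x₀ (2 * R) \ Metric.ball x₀ R → fderiv ℝ θ x = 0 := by
  -- Outer radius 3/2 rather than 2 keeps the closed support inside the open ball of radius 2R.
  let β : ContDiffBump (0 : E n) := ⟨1, 3 / 2, one_pos, by norm_num⟩
  have hβ : ContDiff ℝ ∞ β := β.contDiff
  obtain ⟨C, hC⟩ := (β.hasCompactSupport.fderiv ℝ).exists_bound_of_continuous
    (hβ.continuous_fderiv (by simp))
  refine ⟨max C 1, by positivity, fun R hR => ?_⟩
  have hnorm : ∀ x, ‖R⁻¹ • (x - x₀)‖ = dist x x₀ / R := fun x => by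
    rw [norm_smul, norm_inv, Real.norm_of_nonneg hR.le, dist_eq_norm, inv_mul_eq_div]
  set θ : E n → ℝ := fun x => β (R⁻¹ • (x - x₀)) with hθ
  have hsmooth : ContDiff ℝ ∞ θ := hβ.comp ((contDiff_id.sub contDiff_const).const_smul R⁻¹)
  have htsup : tsupport θ ⊆ Metric.closedBall x₀ (3 / 2 * R) := by
    refine closure_minimal (fun x hx => ?_) Metric.isClosed_closedBall
    by_contra h
    refine hx (β.zero_of_le_dist ?_)
    rw [dist_zero_right, hnorm, le_div_iff₀ hR]
    rw [Metric.mem_closedBall, not_le] at h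
    exact h.le
  have hsub : tsupport θ ⊆ Metric.ball x₀ (2 * R) :=
    htsup.trans (Metric.closedBall_subset_ball (by linarith))
  have hone : ∀ x ∈ Metric.ball x₀ R, θ x = 1 := fun x hx => by
    refine β.one_of_mem_closedBall ?_
    rw [mem_closedBall_zero_iff, hnorm]
    exact (div_le_one hR).2 (Metric.mem_ball.1 hx).le
  refine ⟨θ, ⟨hsmooth, ?_, hsub⟩, fun x => β.nonneg, fun x => β.le_one, hone, fun x => ?_,
    fun x hx => ?_⟩
  · exact (isCompact_closedBall _ _).of_isClosed_subset (isClosed_tsupport _) htsup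
  · have hd : HasFDerivAt θ _ x := ((hβ.differentiable (by simp) _).hasFDerivAt).comp x
      (((hasFDerivAt_id x).sub_const x₀).const_smul R⁻¹)
    rw [hd.fderiv, ContinuousLinearMap.comp_smul, ContinuousLinearMap.comp_id, norm_smul, norm_inv,
      Real.norm_of_nonneg hR.le, inv_mul_eq_div]
    gcongr
    exact (hC _).trans (le_max_left _ _)
  · rw [Set.mem_sdiff, not_and_not_right] at hx
    by_cases h : x ∈ Metric.ball x₀ (2 * R)
    · have h1 : θ =ᶠ[𝓝 x] fun _ => 1 := by
        filter_upwards [Metric.isOpen_ball.mem_nhds (hx h)] with y hy using hone y hy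
      rw [h1.fderiv_eq]
      simp
    · by_contra h'
      exact h (hsub (support_fderiv_subset ℝ h'))

section liouville

variable {A : E n → ℝ → E n → E n} {B : E n → ℝ → E n → ℝ} {u : E n → ℝ} {G : E n → E n}

/-- A Caccioppoli estimate for the negative power `u ^ γ`. -/
theorem IsHarmonic.exists_caccioppoli (hp : IsExponent p) (hA : HasGrowth p A)
    (hB : HasLowerOrderGrowth p B) (hu : IsHarmonic p A B u G) (hpos : ∀ x, 0 < u x) {γ : ℝ}
    (hγ : γ < 0) : ∃ (τ C : ℝ) (q : ℕ), 0 < τ ∧ 0 < C ∧ ∀ θ : E n → ℝ,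
      IsTestFunction univ θ → (∀ x, 0 ≤ θ x) → (∀ x, θ x ≤ 1) →
      Integrable (fun x => u x ^ (γ - 1) * θ x ^ q * ‖G x‖ ^ p x) ∧
      τ * ∫ x, u x ^ (γ - 1) * θ x ^ q * ‖G x‖ ^ p x ≤
        C * (∫ x, u x ^ (γ + p x - 1) * ‖fderiv ℝ θ x‖ ^ p x) -
          ∫ x, B x (u x) (G x) * (u x ^ γ * θ x ^ q) := by
  obtain ⟨P, hP1, hP⟩ := hp.exists_le
  have htest := fun η hη => hu.integral_rpow_mul_test hp hA hB hpos γ (η := η) hη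
  obtain ⟨-, a, b, -, -, ⟨a₀, ha₀, ha⟩, hab, ⟨b₀, hb⟩, hAa, hAb⟩ := hA
  have hb₀ : 0 < b₀ := ha₀.trans_le ((ha 0).trans ((hab 0).trans (hb 0)))
  obtain ⟨q, hq⟩ := exists_nat_ge P
  have hq1 : 1 ≤ q := by exact_mod_cast hP1.trans hq
  -- Coercivity yields 2τ times the gradient term; one τ absorbs the cutoff term and the other
  -- remains.
  set τ := -γ * a₀ / 2 with hτ
  have hτ0 : 0 < τ := by
    have : 0 < -γ := by linarith
    positivity
  set K := max 1 (q * b₀ / τ)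
  have hK1 : 1 ≤ K := le_max_left _ _
  have hq0 : 0 < q := hq1
  refine ⟨τ, b₀ * q * K ^ P, q, hτ0, by positivity, fun θ hθ hθ0 hθ1 => ?_⟩
  have huc : ∀ {α : E n → ℝ}, Continuous α → Continuous fun x => u x ^ α x := fun hα =>
    hu.continuous.rpow hα fun x => Or.inl (hpos x).ne'
  have hθc := hθ.smooth.continuous
  have hη : IsTestFunction univ fun x => θ x ^ q := by
    refine ⟨hθ.smooth.pow q, ?_, subset_univ _⟩
    exact hθ.compact.comp_left (g := fun t : ℝ => t ^ q) (zero_pow hq0.ne')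
  obtain ⟨hfi, hfeq⟩ := htest _ hη
  have hleft : Integrable fun x => u x ^ (γ - 1) * θ x ^ q * ‖G x‖ ^ p x :=
    (hu.memW1Loc.locallyIntegrable_grad_rpow hp).integrable_smul_left_of_hasCompactSupport
      ((huc continuous_const).mul (hθc.pow q)) hη.compact.mul_left
  have hE : Integrable fun x => u x ^ (γ + p x - 1) * ‖fderiv ℝ θ x‖ ^ p x := by
    refine Continuous.integrable_of_hasCompactSupport ?_ ?_
    · refine (huc ((continuous_const.add hp.continuous).sub continuous_const)).mul ?_
      exact (hθ.smooth.continuous_fderiv (by simp)).norm.rpow hp.continuous fun x =>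
        Or.inr (by linarith [hp.one_le x])
    · refine (hθ.compact.fderiv ℝ).mono fun x hx h => hx ?_
      have := hp.one_le x
      simp only [h, norm_zero]
      rw [Real.zero_rpow (by linarith), mul_zero]
  refine ⟨hleft, ?_⟩
  rw [← hfeq, ← integral_const_mul, ← integral_const_mul, ← integral_sub (hE.const_mul _) hfi]
  refine integral_mono (hleft.const_mul τ) ((hE.const_mul _).sub hfi) fun x => ?_
  have hgrad : ‖gradient (fun x => θ x ^ q) x‖ ≤ q * θ x ^ (q - 1) * ‖fderiv ℝ θ x‖ := by
    have hd : HasFDerivAt (fun x => θ x ^ q) _ x :=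
      ((hθ.smooth.differentiable (by simp) x).hasFDerivAt).pow q
    rw [gradient, LinearIsometryEquiv.norm_map, hd.fderiv]
    have := hθ0 x
    rw [norm_smul, Real.norm_of_nonneg (by positivity)]
    simp
  have hθx := hθ0 x
  have hux := hpos x
  have hA1 : ‖A x (u x) (G x)‖ ≤ b₀ * ‖G x‖ ^ (p x - 1) :=
    (hAb _ _ _).trans (by gcongr; exact hb x)
  have hA2 : a₀ * ‖G x‖ ^ p x ≤ inner ℝ (A x (u x) (G x)) (G x) :=
    le_trans (by gcongr; exact ha x) (hAa _ _ _)
  have hterm : |u x ^ γ * inner ℝ (A x (u x) (G x)) (gradient (fun x => θ x ^ q) x)| ≤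
      (b₀ * ‖G x‖ ^ (p x - 1)) * (u x ^ γ * (q * θ x ^ (q - 1) * ‖fderiv ℝ θ x‖)) := by
    rw [abs_mul, abs_of_nonneg (by positivity : 0 ≤ u x ^ γ)]
    calc _ ≤ u x ^ γ * ((b₀ * ‖G x‖ ^ (p x - 1)) * (q * θ x ^ (q - 1) * ‖fderiv ℝ θ x‖)) := by
          gcongr
          refine (abs_real_inner_le_norm _ _).trans ?_
          gcongr
      _ = _ := by ring
  have hyoung := cutoff_term_le (γ := γ) hb₀.le hτ0 hK1 (le_max_right _ _) hux hθx (hθ1 x)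
    (norm_nonneg (G x)) (norm_nonneg (fderiv ℝ θ x)) (hp.one_le x) (hP x) hq
  have hmain : -γ * (u x ^ (γ - 1) * θ x ^ q) * (a₀ * ‖G x‖ ^ p x) ≤
      -γ * (u x ^ (γ - 1) * θ x ^ q) * inner ℝ (A x (u x) (G x)) (G x) := by
    have : 0 ≤ -γ := by linarith
    gcongr
  have habs := (le_abs_self _).trans (hterm.trans hyoung)
  simp only [inner_add_right, real_inner_smul_right]
  have h2τ : -γ * a₀ = 2 * τ := by rw [hτ]; ring
  have hmain' : 2 * τ * (u x ^ (γ - 1) * θ x ^ q * ‖G x‖ ^ p x) ≤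
      -γ * (u x ^ (γ - 1) * θ x ^ q) * inner ℝ (A x (u x) (G x)) (G x) := by
    rw [← h2τ]
    linarith
  linarith

/-! ### Vanishing gradient and decay of the error term -/

/-- Each mollification of `u` is differentiable with zero gradient, hence constant, and they
converge pointwise to `u`. -/
theorem MemW1Loc.exists_eq_const (h : MemW1Loc p u G) (hu : Continuous u) (hG : G =ᵐ[volume] 0) :
    ∃ C, ∀ x, u x = C := by
  have h0 : ∀ k x, mollify k G x = 0 := fun k x => by
    rw [mollify_apply]
    refine integral_eq_zero_of_ae ?_
    filter_upwards [hG] with t ht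
    simp [ht]
  have hconst : ∀ k x, mollify k u x = mollify k u 0 := fun k x => by
    have hd : ∀ y, HasFDerivAt (mollify k u) (0 : E n →L[ℝ] ℝ) y := fun y => by
      have := (h.hasGradientAt_mollify hu k y).hasFDerivAt
      rwa [h0, map_zero] at this
    exact is_const_of_fderiv_eq_zero (𝕜 := ℝ) (fun y => (hd y).differentiableAt)
      (fun y => (hd y).fderiv) x 0
  refine ⟨u 0, fun x => tendsto_nhds_unique (tendsto_mollify_of_continuous hu x) ?_⟩
  simp_rw [hconst _ x]
  exact tendsto_mollify_of_continuous hu 0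

/-- The error term of the Caccioppoli estimate decays on annuli on which the exponent is large. -/
theorem integral_cutoff_error_le (hp : IsExponent p) {P : ℝ} (hP : ∀ x, p x ≤ P)
    (hpos : ∀ x, 0 < u x) {M : ℝ} (hM1 : 1 ≤ M) (hM : ∀ x, u x ≤ M) {δ γ : ℝ}
    (hδ : 0 < δ) (hγ : γ < 0) {x₀ : E n} {R C : ℝ} (hR : 0 < R) (hC : 0 < C) (hCR : C ≤ R)
    (hpR : (((n : ℝ) + δ + 1 - γ : ℝ) : EReal) ≤
      pMinus p (Metric.ball x₀ (2 * R) \ Metric.ball x₀ R)) {θ : E n → ℝ}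
    (hθ : ∀ x, ‖fderiv ℝ θ x‖ ≤ C / R)
    (hθ0 : ∀ x, x ∉ Metric.ball x₀ (2 * R) \ Metric.ball x₀ R → fderiv ℝ θ x = 0) :
    ∫ x, u x ^ (γ + p x - 1) * ‖fderiv ℝ θ x‖ ^ p x ≤
      M ^ P * (2 * C) ^ n * volume.real (Metric.closedBall (0 : E n) 1) * (C / R) ^ δ := by
  set S := Metric.ball x₀ (2 * R) \ Metric.ball x₀ R with hS
  have hae : ∀ᵐ x ∂volume.restrict S, (n : ℝ) + δ + 1 - γ ≤ p x := by
    filter_upwards [ae_essInf_le (f := fun x => (p x : EReal)) (μ := volume.restrict S)] with x hx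
    have := hpR.trans hx
    exact_mod_cast this
  have hzero : ∀ x, x ∉ S → u x ^ (γ + p x - 1) * ‖fderiv ℝ θ x‖ ^ p x = 0 := fun x hx => by
    have := hp.one_le x
    rw [hθ0 x hx, norm_zero, Real.zero_rpow (by linarith), mul_zero]
  have hM0 : 0 < M := by linarith
  rw [← setIntegral_eq_integral_of_forall_compl_eq_zero hzero]
  have hSfin : volume S < ⊤ := (measure_mono sdiff_subset).trans_lt measure_ball_lt_top
  have hbd : ∫ x in S, u x ^ (γ + p x - 1) * ‖fderiv ℝ θ x‖ ^ p x ≤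
      ∫ _ in S, M ^ P * (C / R) ^ ((n : ℝ) + δ) := by
    refine integral_mono_of_nonneg (Eventually.of_forall fun x => ?_)
      (integrableOn_const hSfin.ne) ?_
    · have := hpos x
      positivity
    · filter_upwards [hae] with x hx
      have hux := hpos x
      have hn : (0 : ℝ) ≤ n := n.cast_nonneg
      have hpx := hp.one_le x
      gcongr
      -- The exponent is at least n + δ ≥ 0, so an upper bound for `u` suffices; it is at most `P`
      -- because `γ < 0`.
      · calc u x ^ (γ + p x - 1) ≤ M ^ (γ + p x - 1) :=
            Real.rpow_le_rpow hux.le (hM x) (by linarith)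
          _ ≤ M ^ P := Real.rpow_le_rpow_of_exponent_le hM1 (by linarith [hP x])
      · calc ‖fderiv ℝ θ x‖ ^ p x ≤ (C / R) ^ p x :=
            Real.rpow_le_rpow (norm_nonneg _) (hθ x) (by linarith)
          _ ≤ (C / R) ^ ((n : ℝ) + δ) := Real.rpow_le_rpow_of_exponent_ge (by positivity)
            ((div_le_one hR).2 hCR) (by linarith)
  refine hbd.trans ?_
  have hvol : volume.real S ≤ (2 * R) ^ n * volume.real (Metric.closedBall (0 : E n) 1) := by
    refine (measureReal_mono (sdiff_subset.trans Metric.ball_subset_closedBall)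
      measure_closedBall_lt_top.ne).trans_eq ?_
    rw [Measure.addHaar_real_closedBall' _ _ (by positivity : 0 ≤ 2 * R),
      finrank_euclideanSpace_fin]
  rw [setIntegral_const, smul_eq_mul, Real.rpow_add (by positivity), Real.rpow_natCast]
  calc volume.real S * (M ^ P * ((C / R) ^ n * (C / R) ^ δ))
      ≤ (2 * R) ^ n * volume.real (Metric.closedBall (0 : E n) 1) *
        (M ^ P * ((C / R) ^ n * (C / R) ^ δ)) := by gcongr
    _ = _ := by
      have : (2 * R) ^ n * (C / R) ^ n = (2 * C) ^ n := by
        rw [← mul_pow]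
        congr 1
        field_simp
      rw [← this]
      ring

end liouville

end VarExp

/-! ### The Liouville theorem -/

theorem theorem4p3 {n : ℕ}
    (p : VarExp.E n → ℝ) (hp : VarExp.IsExponent p)
    (A : VarExp.E n → ℝ → VarExp.E n → VarExp.E n) (hA : VarExp.HasGrowth p A)
    (B : VarExp.E n → ℝ → VarExp.E n → ℝ) (hB : VarExp.HasLowerOrderGrowth p B)
    (δ γ : ℝ) (hδ : 0 < δ) (hγ : γ < 0)
    (x₀ : VarExp.E n) (R : ℕ → ℝ) (hR : Tendsto R atTop atTop)
    (hpR : ∀ k, (((n : ℝ) + δ + 1 - γ : ℝ) : EReal) ≤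
      VarExp.pMinus p (Metric.ball x₀ (2 * R k) \ Metric.ball x₀ (R k)))
    (u : VarExp.E n → ℝ) (G : VarExp.E n → VarExp.E n)
    (hu : VarExp.IsHarmonic p A B u G)
    (hpos : ∀ x, 0 < u x) (hbdd : ∃ M : ℝ, ∀ x, u x ≤ M)
    (hint : Integrable (fun x => B x (u x) (G x) * u x ^ γ) volume)
    (hlim : Tendsto (fun r : ℝ => ∫ x in Metric.ball x₀ r, B x (u x) (G x) * u x ^ γ)
      atTop (𝓝 0)) :
    ∃ C : ℝ, ∀ x, u x = C := by
  obtain ⟨M', hM'⟩ := hbdd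
  set M := max 1 M'
  have hM1 : 1 ≤ M := le_max_left _ _
  have hM : ∀ x, u x ≤ M := fun x => (hM' x).trans (le_max_right _ _)
  obtain ⟨P, -, hP⟩ := hp.exists_le
  obtain ⟨τ, C₁, q, hτ, hC₁, hcacc⟩ := hu.exists_caccioppoli hp hA hB hpos hγ
  obtain ⟨C, hC, hcut⟩ := VarExp.exists_cutoff x₀
  have hcut' : ∀ k, ∃ θ : VarExp.E n → ℝ, 0 < R k →
      VarExp.IsTestFunction (Metric.ball x₀ (2 * R k)) θ ∧ (∀ x, 0 ≤ θ x) ∧ (∀ x, θ x ≤ 1) ∧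
      (∀ x ∈ Metric.ball x₀ (R k), θ x = 1) ∧ (∀ x, ‖fderiv ℝ θ x‖ ≤ C / R k) ∧
      ∀ x, x ∉ Metric.ball x₀ (2 * R k) \ Metric.ball x₀ (R k) → fderiv ℝ θ x = 0 := fun k => by
    by_cases h : 0 < R k
    · exact (hcut (R k) h).imp fun θ hθ _ => hθ
    -- `R k` is positive only eventually; for the other indices any function will do.
    · exact ⟨0, fun h' => absurd h' h⟩
  choose θ hθ using hcut'
  have hball : ∀ x, ∀ᶠ r : ℝ in atTop, x ∈ Metric.ball x₀ r := fun x =>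
    (eventually_gt_atTop (dist x x₀)).mono fun r hr => hr
  -- By integrability the integrals over balls converge to the full integral, so the hypothesis says
  -- that the latter is zero.
  have hzero : ∫ x, B x (u x) (G x) * u x ^ γ = 0 := by
    refine tendsto_nhds_unique ?_ hlim
    simp_rw [← integral_indicator (measurableSet_ball (x := x₀))]
    refine tendsto_integral_filter_of_dominated_convergence
      (fun x => ‖B x (u x) (G x) * u x ^ γ‖) (Eventually.of_forall fun r =>
        hint.aestronglyMeasurable.indicator measurableSet_ball)
      (Eventually.of_forall fun r => Eventually.of_forall fun x => norm_indicator_le_norm_self _ _)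
      hint.norm (Eventually.of_forall fun x => ?_)
    exact tendsto_const_nhds.congr' ((hball x).mono fun r hr => (indicator_of_mem hr _).symm)
  have hRpos : ∀ᶠ k in atTop, 0 < R k := hR.eventually_gt_atTop 0
  have hBlim : Tendsto (fun k => ∫ x, B x (u x) (G x) * (u x ^ γ * θ k x ^ q)) atTop (𝓝 0) := by
    rw [← hzero]
    refine tendsto_integral_filter_of_dominated_convergence
      (fun x => ‖B x (u x) (G x) * u x ^ γ‖) ?_ ?_ hint.norm (Eventually.of_forall fun x => ?_)
    · filter_upwards [hRpos] with k hk
      simp_rw [← mul_assoc]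
      exact hint.aestronglyMeasurable.mul
        ((hθ k hk).1.smooth.continuous.pow q).aestronglyMeasurable
    · filter_upwards [hRpos] with k hk
      refine Eventually.of_forall fun x => ?_
      obtain ⟨-, h0, h1, -⟩ := hθ k hk
      rw [← mul_assoc, norm_mul, Real.norm_of_nonneg (pow_nonneg (h0 x) q)]
      exact mul_le_of_le_one_right (norm_nonneg _) (pow_le_one₀ (h0 x) (h1 x))
    · refine tendsto_const_nhds.congr' ?_
      filter_upwards [hRpos, hR.eventually (hball x)] with k hk hx
      rw [(hθ k hk).2.2.2.1 x hx, one_pow, mul_one]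
  have herr : Tendsto (fun k => C₁ * (M ^ P * (2 * C) ^ n *
      volume.real (Metric.closedBall (0 : VarExp.E n) 1) * (C / R k) ^ δ) -
      ∫ x, B x (u x) (G x) * (u x ^ γ * θ k x ^ q)) atTop (𝓝 0) := by
    have h1 : Tendsto (fun k => (C / R k) ^ δ) atTop (𝓝 0) := by
      have := (hR.const_div_atTop C).rpow_const (p := δ) (Or.inr hδ.le)
      rwa [Real.zero_rpow hδ.ne'] at this
    simpa using ((h1.const_mul (M ^ P * (2 * C) ^ n *
      volume.real (Metric.closedBall (0 : VarExp.E n) 1))).const_mul C₁).sub hBlim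
  have hGball : ∀ r : ℝ, ∀ᵐ x, x ∈ Metric.ball x₀ r → G x = 0 := fun r => by
    have hwpos : ∀ x, 0 ≤ u x ^ (γ - 1) * ‖G x‖ ^ p x := fun x => by
      have := hpos x
      positivity
    -- For fixed `r`, the cutoff is 1 on the ball of radius `r` once `R k ≥ r`, so the left-hand
    -- side stops depending on `k`.
    have hev : ∀ᶠ k in atTop,
        IntegrableOn (fun x => u x ^ (γ - 1) * ‖G x‖ ^ p x) (Metric.ball x₀ r) ∧
        τ * ∫ x in Metric.ball x₀ r, u x ^ (γ - 1) * ‖G x‖ ^ p x ≤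
          C₁ * (M ^ P * (2 * C) ^ n * volume.real (Metric.closedBall (0 : VarExp.E n) 1) *
            (C / R k) ^ δ) - ∫ x, B x (u x) (G x) * (u x ^ γ * θ k x ^ q) := by
      filter_upwards [hRpos, hR.eventually_ge_atTop C, hR.eventually_ge_atTop r] with k hk hCk hrk
      obtain ⟨ht, h0, h1, hone, hd, hd0⟩ := hθ k hk
      obtain ⟨hi, hle⟩ := hcacc (θ k) ⟨ht.smooth, ht.compact, subset_univ _⟩ h0 h1
      have herrk := VarExp.integral_cutoff_error_le hp hP hpos hM1 hM hδ hγ hk hC hCk (hpR k) hd hd0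
      have heq : ∀ x ∈ Metric.ball x₀ r, u x ^ (γ - 1) * θ k x ^ q * ‖G x‖ ^ p x =
          u x ^ (γ - 1) * ‖G x‖ ^ p x := fun x hx => by
        rw [hone x (Metric.ball_subset_ball hrk hx), one_pow, mul_one]
      refine ⟨hi.integrableOn.congr_fun heq measurableSet_ball, ?_⟩
      rw [← setIntegral_congr_fun measurableSet_ball heq]
      have hset : ∫ x in Metric.ball x₀ r, u x ^ (γ - 1) * θ k x ^ q * ‖G x‖ ^ p x ≤
          ∫ x, u x ^ (γ - 1) * θ k x ^ q * ‖G x‖ ^ p x :=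
        setIntegral_le_integral hi (Eventually.of_forall fun x => by
          have := hpos x
          have := h0 x
          positivity)
      have h2 := mul_le_mul_of_nonneg_left hset hτ.le
      have h3 := mul_le_mul_of_nonneg_left herrk hC₁.le
      linarith
    obtain ⟨k, hk, -⟩ := hev.exists
    have hle : τ * ∫ x in Metric.ball x₀ r, u x ^ (γ - 1) * ‖G x‖ ^ p x ≤ 0 :=
      ge_of_tendsto herr (hev.mono fun k hk => hk.2)
    have hint0 : ∫ x in Metric.ball x₀ r, u x ^ (γ - 1) * ‖G x‖ ^ p x = 0 :=
      le_antisymm (nonpos_of_mul_nonpos_right hle hτ) (integral_nonneg hwpos)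
    rw [← ae_restrict_iff' measurableSet_ball]
    filter_upwards [(integral_eq_zero_iff_of_nonneg hwpos hk).1 hint0] with x hx
    rcases mul_eq_zero.1 hx with h | h
    · exact absurd h (Real.rpow_pos_of_pos (hpos x) _).ne'
    · exact norm_eq_zero.1 ((Real.rpow_eq_zero_iff_of_nonneg (norm_nonneg _)).1 h).1
  refine hu.memW1Loc.exists_eq_const hu.continuous ?_
  have hGall : ∀ᵐ x, ∀ N : ℕ, x ∈ Metric.ball x₀ N → G x = 0 := ae_all_iff.2 fun N => hGball N
  filter_upwards [hGall] with x hx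
  obtain ⟨N, hN⟩ := exists_nat_gt (dist x x₀)
  exact hx N hN
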